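/- Let $d\ge1$ be an integer, let $\mu$ be the uniform probability measure on the unit sphere $\mathbb S^d\subset\mathbb R^{d+1}$, and let $\nabla$ and $\Delta$ be the gradient and the Laplace–Beltrami operator of the round metric on $\mathbb S^d$. Put $2^\#:=\frac{2d^2+1}{(d-1)^2}$ (with $2^\#:=\infty$ if $d=1$), and $2^*:=\frac{2d}{d-2}$ if $d\ge3$, $2^*:=\infty$ if $d=1$ or $2$. For a positive function $\rho$ on $\mathbb S^d$ and $p>2$, define $$\mathcal E_p[\rho]:=\frac1{p-2}\left[\left(\int_{\mathbb S^d}\rho\,d\mu\right)^{2/p}-\int_{\mathbb S^d}\rho^{2/p}\,d\mu\right],\qquad \mathcal I_p[\rho]:=\int_{\mathbb S^d}\left|\nabla\rho^{1/p}\right|^2d\mu .$$ A classical solution of the heat flow with initial datum $\rho_0$ is a continuous function $\rho$ on $[0,\infty)\times\mathbb S^d$ with $\rho(0,\cdot)=\rho_0$ that is, for every $t>0$, of class $C^2$ in the space variable, and that is differentiable in $t>0$ with $\frac{\partial\rho}{\partial t}=\Delta\rho$ at every point of $(0,\infty)\times\mathbb S^d$. Let $p$ be a real number such that $2^\#<p<2^*$,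 or $p=2^*$ and $d\ge3$ (in which case $p>2^\#$). Then there exists a smooth positive function $\rho_0$ on $\mathbb S^d$ such that a classical solution of the heat flow with initial datum $\rho_0$ exists and, for every such solution $\rho$, the function $t\mapsto\mathcal I_p[\rho(t,\cdot)]-d\,\mathcal E_p[\rho(t,\cdot)]$ on $[0,\infty)$ is differentiable (from the right) at $t=0$ with $$\frac{d}{dt}\Big(\mathcal I_p[\rho(t,\cdot)]-d\,\mathcal E_p[\rho(t,\cdot)]\Big)_{|t=0}>0 .$$ -/

import Mathlib

open MeasureTheory Set Metric
open scoped Manifold ContDiff Laplacian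

noncomputable section

/-- The unit sphere `S^d` of `ℝ^(d+1)`. -/
abbrev Sph (d : ℕ) : Type := sphere (0 : EuclideanSpace ℝ (Fin (d + 1))) 1

namespace Sph

/-- The exponent `2^# = (2 d² + 1) / (d - 1)²`, with value `∞` for `d = 1`. -/
def twoSharp (d : ℕ) : ENNReal :=
  if d = 1 then ⊤ else ENNReal.ofReal ((2 * (d : ℝ) ^ 2 + 1) / ((d : ℝ) - 1) ^ 2)

/-- The exponent `2^* = 2 d / (d - 2)` if `d ≥ 3`, and `2^* = ∞` if `d = 1` or `d = 2`. -/
def twoStar (d : ℕ) : ENNReal :=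
  if 3 ≤ d then ENNReal.ofReal (2 * (d : ℝ) / ((d : ℝ) - 2)) else ⊤

/-- The uniform probability measure on `S^d`: the surface measure induced by the Lebesgue measure,
divided by its total mass. -/
def unif (d : ℕ) : Measure (Sph d) :=
  ((volume : Measure (EuclideanSpace ℝ (Fin (d + 1)))).toSphere univ)⁻¹ •
    (volume : Measure (EuclideanSpace ℝ (Fin (d + 1)))).toSphere

/-- The extension of `f : S^d → ℝ` to `ℝ^(d+1)` that is homogeneous of degree `0`:
`y ↦ f (y / |y|)` for `y ≠ 0` (and, irrelevantly, `0` at the origin). -/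
def ext {d : ℕ} (f : Sph d → ℝ) (y : EuclideanSpace ℝ (Fin (d + 1))) : ℝ :=
  open Classical in
  if hy : y ≠ 0 then f ⟨‖y‖⁻¹ • y, by simp [norm_smul, hy]⟩ else 0

/-- The Riemannian gradient on the round sphere, as a vector of `ℝ^(d+1)`: the Euclidean gradient
of the degree `0` homogeneous extension. It is tangent to the sphere, since this extension is
constant in the radial direction. -/
def grad {d : ℕ} (f : Sph d → ℝ) (x : Sph d) : EuclideanSpace ℝ (Fin (d + 1)) :=
  gradient (ext f) (x : EuclideanSpace ℝ (Fin (d + 1)))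

/-- The Laplace-Beltrami operator on the round sphere: the restriction to the sphere of the
Euclidean Laplacian of the degree `0` homogeneous extension. (In polar coordinates the Euclidean
Laplacian is `∂_r² + (d / r) ∂_r + r⁻² Δ_{S^d}`, and the radial derivatives vanish here.) -/
def laplaceBeltrami {d : ℕ} (f : Sph d → ℝ) (x : Sph d) : ℝ :=
  (Δ (ext f)) (x : EuclideanSpace ℝ (Fin (d + 1)))

/-- The generalized entropy `E_p[ρ]`, for `p ≠ 2`. -/
def entropy {d : ℕ} (p : ℝ) (ρ : Sph d → ℝ) : ℝ :=
  1 / (p - 2) * ((∫ x, ρ x ∂(unif d)) ^ (2 / p) - ∫ x, ρ x ^ (2 / p) ∂(unif d))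

/-- The generalized Fisher information `I_p[ρ] = ∫ |∇ ρ^(1/p)|² dμ`. -/
def fisher {d : ℕ} (p : ℝ) (ρ : Sph d → ℝ) : ℝ :=
  ∫ x, ‖grad (fun y => ρ y ^ (1 / p)) x‖ ^ 2 ∂(unif d)

/-- `ρ` is a classical solution on `[0, ∞) × S^d` of the heat equation `∂ρ/∂t = Δρ` with initial
datum `ρ₀`. The values of `ρ` at negative times are irrelevant. -/
structure IsHeatSolution {d : ℕ} (ρ₀ : Sph d → ℝ) (ρ : ℝ → Sph d → ℝ) : Prop where
  /-- `ρ` is continuous up to the initial time. -/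
  continuousOn : ContinuousOn (fun q : ℝ × Sph d => ρ q.1 q.2) (Ici 0 ×ˢ univ)
  /-- At positive times, `ρ` is of class `C²` in the space variable. -/
  contMDiff : ∀ t : ℝ, 0 < t → ContMDiff (𝓡 d) 𝓘(ℝ, ℝ) 2 (ρ t)
  /-- At positive times, `ρ` satisfies the equation pointwise. -/
  equation : ∀ t : ℝ, 0 < t → ∀ x : Sph d,
    HasDerivAt (fun s => ρ s x) (laplaceBeltrami (ρ t) x) t
  /-- The initial datum is `ρ₀`. -/
  initial : ∀ x : Sph d, ρ 0 x = ρ₀ x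

end Sph

end

/-! The construction stays within zonal functions `ρ = P(z)`, where `z` is the first coordinate. On
them the Laplace–Beltrami operator is `L = (1 - z²)∂² - d z ∂`, which acts triangularly on
polynomials with distinct eigenvalues. A polynomial datum therefore has an explicit flow, a finite
sum of exponentials in time, and the maximum principle shows that every classical solution coincides
with it for `t ≥ 0`.

Write `u = ρ^(1/p)`. Differentiating under the integral and integrating by parts turns the
derivative of `I_p - d E_p` at time `0` into `-2 ∫ (1 - z²)² u² (X² - 2κXY + cY²) dμ`, with `X =
u''/u`, `Y = (u'/u)²`, `κ = (p-1)(d-1)/(d+2)`, `c = (p-1)d/(d+2)`. The quadratic form takes negative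
values on `Y > 0` when `κ² > c`, that is, `(p-1)(d-1)² > d(d+2)`, which is exactly `p > 2^#`. Its
minimum in `X` is at `X = κY`; solving `u u'' = κ u'²` gives `u = (2 - z)^(-1/(κ-1))`, so `ρ = (2 -
z)^(-m)` with `m = p/(κ-1)`. For this `ρ` the integrand is positive on all of `-1 < z < 1`. A
polynomial close to it in `C²` keeps the integral positive and is the datum.

The main steps are `integral_rate_eq` (the formula), `deficitRate_extremal` (the profile),
`exists_polynomial_deficit_pos` (the approximation), `exists_zonal_heat_flow` and
`IsHeatSolution.unique`. -/

open Filter Topology Polynomial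

/-! ### Second derivatives along lines -/

section LineDerivatives

variable {E : Type*} [NormedAddCommGroup E] [NormedSpace ℝ E]

theorem hasDerivAt_comp_line {f : E → ℝ} {x v : E} {s : ℝ}
    (hf : DifferentiableAt ℝ f (x + s • v)) :
    HasDerivAt (fun r : ℝ => f (x + r • v)) (fderiv ℝ f (x + s • v) v) s := by
  have h : HasDerivAt (fun r : ℝ => x + r • v) v s := by
    simpa using ((hasDerivAt_id s).smul_const v).const_add x
  exact hf.hasFDerivAt.comp_hasDerivAt s h

theorem tendsto_line (x v : E) : Tendsto (fun r : ℝ => x + r • v) (𝓝 0) (𝓝 x) := by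
  have : Continuous fun r : ℝ => x + r • v := by fun_prop
  simpa using this.tendsto 0

theorem iteratedFDeriv_two_eq_deriv_deriv {f : E → ℝ} {x : E} (hf : ContDiffAt ℝ 2 f x) (v : E) :
    iteratedFDeriv ℝ 2 f x ![v, v] = deriv (deriv fun s : ℝ => f (x + s • v)) 0 := by
  have hev : ∀ᶠ s : ℝ in 𝓝 0, DifferentiableAt ℝ f (x + s • v) := by
    have h1 : ∀ᶠ y in 𝓝 x, ContDiffAt ℝ 2 f y := hf.eventually (by simp)
    exact ((tendsto_line x v).eventually h1).mono fun s hs => hs.differentiableAt (by simp)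
  have h1 : deriv (fun s : ℝ => f (x + s • v)) =ᶠ[𝓝 0] fun s => fderiv ℝ f (x + s • v) v :=
    hev.mono fun s hs => (hasDerivAt_comp_line hs).deriv
  have h2 : DifferentiableAt ℝ (fderiv ℝ f) x :=
    (hf.fderiv_right (m := 1) (by norm_num)).differentiableAt (by simp)
  have h3 : HasDerivAt (fun r : ℝ => x + r • v) v 0 := by
    simpa using ((hasDerivAt_id (0 : ℝ)).smul_const v).const_add x
  have h4 : HasFDerivAt (fun y => fderiv ℝ f y v)
      ((ContinuousLinearMap.apply ℝ ℝ v).comp (fderiv ℝ (fderiv ℝ f) x)) x :=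
    (ContinuousLinearMap.apply ℝ ℝ v).hasFDerivAt.comp x h2.hasFDerivAt
  have h5 : HasDerivAt (fun s : ℝ => fderiv ℝ f (x + s • v) v)
      (((ContinuousLinearMap.apply ℝ ℝ v).comp (fderiv ℝ (fderiv ℝ f) x)) v) 0 :=
    HasFDerivAt.comp_hasDerivAt_of_eq (0 : ℝ) h4 h3 (by simp)
  rw [h1.deriv_eq, iteratedFDeriv_two_apply, h5.deriv]
  rfl

/-- A positive second derivative would make the point a local minimum as well, so `f` would be
locally constant and its second derivative zero. -/
theorem deriv_deriv_nonpos_of_isLocalMax {f : ℝ → ℝ} {x : ℝ} (hf : ContinuousAt f x)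
    (h : IsLocalMax f x) : deriv (deriv f) x ≤ 0 := by
  by_contra! hpos
  have hmin := isLocalMin_of_deriv_deriv_pos hpos h.deriv_eq_zero hf
  have hconst : f =ᶠ[𝓝 x] fun _ => f x := by
    filter_upwards [h, hmin] with y h1 h2 using le_antisymm h1 h2
  have h2 : deriv f =ᶠ[𝓝 x] deriv fun _ => f x := hconst.deriv
  rw [h2.deriv_eq] at hpos
  simp at hpos

end LineDerivatives

/-! ### Degree-zero extensions and the Laplace–Beltrami operator -/

namespace Sph

variable {d : ℕ}

/-- The first coordinate on the sphere. -/
def height (x : Sph d) : ℝ := (x : EuclideanSpace ℝ (Fin (d + 1))) 0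

theorem continuous_height : Continuous (height : Sph d → ℝ) := by
  unfold height
  fun_prop

theorem sum_sq_coord (x : Sph d) : ∑ i, (x : EuclideanSpace ℝ (Fin (d + 1))) i ^ 2 = 1 := by
  have h := EuclideanSpace.norm_sq_eq (x : EuclideanSpace ℝ (Fin (d + 1)))
  simpa using h.symm

theorem abs_coord_le (x : Sph d) (i) : |(x : EuclideanSpace ℝ (Fin (d + 1))) i| ≤ 1 := by
  have h := PiLp.norm_apply_le (x : EuclideanSpace ℝ (Fin (d + 1))) i
  rwa [norm_eq_of_mem_sphere] at h

theorem height_mem (x : Sph d) : height x ∈ Icc (-1 : ℝ) 1 := abs_le.1 (abs_coord_le x 0)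

theorem ext_of_ne (f : Sph d → ℝ) {y : EuclideanSpace ℝ (Fin (d + 1))} (hy : y ≠ 0) :
    ext f y = f ⟨‖y‖⁻¹ • y, by simp [norm_smul, hy]⟩ := by
  simp [ext, hy]

theorem ext_coe (f : Sph d → ℝ) (x : Sph d) : ext f x = f x := by
  rw [ext_of_ne f (ne_zero_of_mem_unit_sphere x)]
  congr 1
  ext1
  simp

theorem ext_sub (f g : Sph d → ℝ) : ext (fun x => f x - g x) = fun y => ext f y - ext g y := by
  ext y
  by_cases hy : y = 0 <;> simp [ext, hy]

/-- Away from the origin the extension is `f` composed with the smooth retraction `y ↦ y / |y|`. -/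
theorem contDiffAt_ext {f : Sph d → ℝ} (hf : ContMDiff (𝓡 d) 𝓘(ℝ, ℝ) 2 f) (x : Sph d) :
    ContDiffAt ℝ 2 (ext f) (x : EuclideanSpace ℝ (Fin (d + 1))) := by
  let U : TopologicalSpace.Opens (EuclideanSpace ℝ (Fin (d + 1))) := ⟨{0}ᶜ, isOpen_compl_singleton⟩
  let n : U → EuclideanSpace ℝ (Fin (d + 1)) := fun y => ‖(y : EuclideanSpace ℝ (Fin (d + 1)))‖⁻¹ • y
  have hn : ContMDiff 𝓘(ℝ, EuclideanSpace ℝ (Fin (d + 1))) 𝓘(ℝ, EuclideanSpace ℝ (Fin (d + 1))) 2 n := by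
    intro y
    have hy : (y : EuclideanSpace ℝ (Fin (d + 1))) ≠ 0 := y.2
    have h1 : ContDiffAt ℝ 2 (fun z : EuclideanSpace ℝ (Fin (d + 1)) => ‖z‖⁻¹ • z) y :=
      ((contDiffAt_norm ℝ hy).inv (norm_ne_zero_iff.2 hy)).smul contDiffAt_id
    exact h1.contMDiffAt.comp y (contMDiff_subtype_val y)
  have hns : ∀ y, n y ∈ sphere (0 : EuclideanSpace ℝ (Fin (d + 1))) 1 := by
    intro y
    have hy : (y : EuclideanSpace ℝ (Fin (d + 1))) ≠ 0 := y.2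
    simp [n, norm_smul, hy]
  have := Fact.mk (@finrank_euclideanSpace_fin ℝ _ (d + 1))
  have h2 := hf.comp (ContMDiff.codRestrict_sphere (n := d) hn hns)
  have hx : (x : EuclideanSpace ℝ (Fin (d + 1))) ∈ U := ne_zero_of_mem_unit_sphere x
  have h3 : ContMDiffAt 𝓘(ℝ, EuclideanSpace ℝ (Fin (d + 1))) 𝓘(ℝ, ℝ) 2
      (fun y : U => ext f y) ⟨x, hx⟩ := by
    refine (h2 ⟨x, hx⟩).congr_of_eventuallyEq (Eventually.of_forall fun y => ?_)
    have hy : (y : EuclideanSpace ℝ (Fin (d + 1))) ≠ 0 := y.2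
    exact ext_of_ne f hy
  exact (contMDiffAt_subtype_iff.1 h3).contDiffAt

theorem laplaceBeltrami_eq_sum {f : Sph d → ℝ} {x : Sph d}
    (hf : ContDiffAt ℝ 2 (ext f) (x : EuclideanSpace ℝ (Fin (d + 1)))) :
    laplaceBeltrami f x = ∑ i : Fin (d + 1), deriv (deriv fun s : ℝ =>
      ext f ((x : EuclideanSpace ℝ (Fin (d + 1))) + s • EuclideanSpace.single i (1 : ℝ))) 0 := by
  unfold laplaceBeltrami
  rw [InnerProductSpace.laplacian_eq_iteratedFDeriv_orthonormalBasis (ext f)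
    (EuclideanSpace.basisFun (Fin (d + 1)) ℝ)]
  refine Finset.sum_congr rfl fun i _ => ?_
  simp only [EuclideanSpace.basisFun_apply]
  exact iteratedFDeriv_two_eq_deriv_deriv hf _

theorem laplaceBeltrami_sub {f g : Sph d → ℝ} (hf : ContMDiff (𝓡 d) 𝓘(ℝ, ℝ) 2 f)
    (hg : ContMDiff (𝓡 d) 𝓘(ℝ, ℝ) 2 g) (x : Sph d) :
    laplaceBeltrami (fun y => f y - g y) x = laplaceBeltrami f x - laplaceBeltrami g x := by
  unfold laplaceBeltrami
  rw [ext_sub]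
  exact (contDiffAt_ext hf x).laplacian_sub (contDiffAt_ext hg x)

/-! ### Maximum principle and uniqueness -/

theorem laplaceBeltrami_nonpos_of_max {f : Sph d → ℝ} (hf : ContMDiff (𝓡 d) 𝓘(ℝ, ℝ) 2 f)
    {x : Sph d} (hx : ∀ y, f y ≤ f x) : laplaceBeltrami f x ≤ 0 := by
  rw [laplaceBeltrami_eq_sum (contDiffAt_ext hf x)]
  refine Finset.sum_nonpos fun i _ => deriv_deriv_nonpos_of_isLocalMax ?_ ?_
  · have h := (contDiffAt_ext hf x).continuousAt
    have h2 := tendsto_line (x : EuclideanSpace ℝ (Fin (d + 1)))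
      (EuclideanSpace.single i (1 : ℝ))
    unfold ContinuousAt
    simpa [Function.comp_def] using h.tendsto.comp h2
  · have hne : ∀ᶠ y in 𝓝 (x : EuclideanSpace ℝ (Fin (d + 1))), y ≠ 0 :=
      isOpen_ne.mem_nhds (ne_zero_of_mem_unit_sphere x)
    filter_upwards [(tendsto_line (x : EuclideanSpace ℝ (Fin (d + 1)))
      (EuclideanSpace.single i (1 : ℝ))).eventually hne] with s hs
    rw [ext_of_ne f hs]
    simpa [ext_coe] using hx _

/-- **Weak maximum principle** for the heat equation on the sphere with zero initial datum. -/
theorem nonpos_of_heat {w : ℝ → Sph d → ℝ}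
    (hc : ContinuousOn (fun q : ℝ × Sph d => w q.1 q.2) (Ici 0 ×ˢ univ))
    (hs : ∀ t : ℝ, 0 < t → ContMDiff (𝓡 d) 𝓘(ℝ, ℝ) 2 (w t))
    (he : ∀ t : ℝ, 0 < t → ∀ x, HasDerivAt (fun s => w s x) (laplaceBeltrami (w t) x) t)
    (h0 : ∀ x, w 0 x ≤ 0) {T : ℝ} (hT : 0 ≤ T) (x : Sph d) : w T x ≤ 0 := by
  -- Subtracting `ε t` makes the inequality strict: at a positive-time maximum of `w - ε t` the
  -- equation would force `0 ≤ Δw - ε < 0`.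
  have key : ∀ ε > 0, w T x ≤ ε * T := by
    intro ε hε
    have hK : IsCompact (Icc 0 T ×ˢ (univ : Set (Sph d))) := isCompact_Icc.prod isCompact_univ
    have hcont : ContinuousOn (fun q : ℝ × Sph d => w q.1 q.2 - ε * q.1)
        (Icc 0 T ×ˢ (univ : Set (Sph d))) :=
      (hc.mono (prod_mono Icc_subset_Ici_self subset_rfl)).sub (by fun_prop)
    obtain ⟨⟨t, y⟩, hty, hmax⟩ := hK.exists_isMaxOn ⟨(T, x), ⟨⟨hT, le_rfl⟩, mem_univ _⟩⟩ hcont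
    have ht : t ∈ Icc 0 T := hty.1
    have hle : w T x - ε * T ≤ w t y - ε * t := 
      hmax (show (T, x) ∈ Icc 0 T ×ˢ univ from ⟨⟨hT, le_rfl⟩, mem_univ _⟩)
    rcases ht.1.eq_or_lt with rfl | htpos
    · linarith [h0 y]
    exfalso
    have hlap : laplaceBeltrami (w t) y ≤ 0 := by
      refine laplaceBeltrami_nonpos_of_max (hs t htpos) fun z => ?_
      have : w t z - ε * t ≤ w t y - ε * t := 
        hmax (show (t, z) ∈ Icc 0 T ×ˢ univ from ⟨ht, mem_univ _⟩)
      linarith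
    -- The maximum may sit at the final time `T`, so only the left derivative can be compared.
    have hd : HasDerivWithinAt (fun s => w s y - ε * s) (laplaceBeltrami (w t) y - ε) (Iio t) t := by
      have h2 : HasDerivAt (fun s => ε * s) ε t := by simpa using (hasDerivAt_id t).const_mul ε
      exact ((he t htpos y).sub h2).hasDerivWithinAt
    have hslope := (hasDerivWithinAt_iff_tendsto_slope' (by simp)).1 hd
    have hge : 0 ≤ laplaceBeltrami (w t) y - ε := by
      refine ge_of_tendsto hslope ?_
      filter_upwards [Ioo_mem_nhdsLT htpos] with s hs
      have : w s y - ε * s ≤ w t y - ε * t :=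
        hmax (show (s, y) ∈ Icc 0 T ×ˢ univ from ⟨⟨hs.1.le, hs.2.le.trans ht.2⟩, mem_univ _⟩)
      rw [slope_def_field]
      exact div_nonneg_of_nonpos (by linarith) (by linarith [hs.2])
    linarith
  by_contra! hlt
  have h := key (w T x / (2 * (T + 1))) (by positivity)
  have h2 : w T x / (2 * (T + 1)) * T < w T x := by
    rw [div_mul_eq_mul_div, div_lt_iff₀ (by positivity)]
    nlinarith
  linarith

theorem IsHeatSolution.unique {ρ₀ : Sph d → ℝ} {ρ σ : ℝ → Sph d → ℝ} (hρ : IsHeatSolution ρ₀ ρ)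
    (hσ : IsHeatSolution ρ₀ σ) {t : ℝ} (ht : 0 ≤ t) : ρ t = σ t := by
  have aux : ∀ {ρ σ : ℝ → Sph d → ℝ}, IsHeatSolution ρ₀ ρ → IsHeatSolution ρ₀ σ →
      ∀ x, ρ t x - σ t x ≤ 0 := by
    intro ρ σ hρ hσ x
    refine nonpos_of_heat (w := fun t x => ρ t x - σ t x) (hρ.continuousOn.sub hσ.continuousOn)
      (fun t ht => (hρ.contMDiff t ht).sub (hσ.contMDiff t ht)) (fun t ht x => ?_)
      (fun x => by simp [hρ.initial, hσ.initial]) ht x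
    rw [laplaceBeltrami_sub (hρ.contMDiff t ht) (hσ.contMDiff t ht)]
    exact (hρ.equation t ht x).sub (hσ.equation t ht x)
  funext x
  linarith [aux hρ hσ x, aux hσ hρ x]

/-! ### Calculus of zonal functions -/

/-- The height of the radial projection of `x + s eᵢ`, where `h = x₀`, `a = xᵢ`, `δ = (eᵢ)₀`. -/
noncomputable def heightLine (h δ a s : ℝ) : ℝ := (h + δ * s) / √(1 + 2 * a * s + s ^ 2)

/-- The derivative of `heightLine h δ a`. -/
noncomputable def heightLineDeriv (h δ a s : ℝ) : ℝ :=
  δ / √(1 + 2 * a * s + s ^ 2) - (h + δ * s) * (a + s) / √(1 + 2 * a * s + s ^ 2) ^ 3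

theorem hasDerivAt_sqrt_line {a s : ℝ} (hs : 0 < 1 + 2 * a * s + s ^ 2) :
    HasDerivAt (fun r : ℝ => √(1 + 2 * a * r + r ^ 2)) ((a + s) / √(1 + 2 * a * s + s ^ 2)) s := by
  have h1 : HasDerivAt (fun r : ℝ => 1 + 2 * a * r + r ^ 2) (2 * a + 2 * s) s := by
    have := (((hasDerivAt_id s).const_mul (2 * a)).const_add 1).add ((hasDerivAt_id s).pow 2)
    refine this.congr_deriv ?_
    simp
  refine (h1.sqrt hs.ne').congr_deriv ?_
  have := (Real.sqrt_pos.2 hs).ne'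
  field_simp

theorem hasDerivAt_heightLine (h δ : ℝ) {a s : ℝ} (hs : 0 < 1 + 2 * a * s + s ^ 2) :
    HasDerivAt (heightLine h δ a) (heightLineDeriv h δ a s) s := by
  have h1 : HasDerivAt (fun r : ℝ => h + δ * r) δ s := by
    simpa using ((hasDerivAt_id s).const_mul δ).const_add h
  have hne := (Real.sqrt_pos.2 hs).ne'
  refine (h1.div (hasDerivAt_sqrt_line hs) hne).congr_deriv ?_
  unfold heightLineDeriv
  field_simp

theorem eventually_line_pos (a : ℝ) : ∀ᶠ s : ℝ in 𝓝 0, 0 < 1 + 2 * a * s + s ^ 2 := by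
  have : Continuous fun s : ℝ => 1 + 2 * a * s + s ^ 2 := by fun_prop
  exact this.tendsto 0 |>.eventually (lt_mem_nhds (by norm_num))

theorem hasDerivAt_heightLineDeriv (h δ a : ℝ) :
    HasDerivAt (heightLineDeriv h δ a) (3 * h * a ^ 2 - h - 2 * δ * a) 0 := by
  have hs := hasDerivAt_sqrt_line (a := a) (s := 0) (by norm_num)
  have h1 : HasDerivAt (fun r : ℝ => h + δ * r) δ 0 := by
    simpa using ((hasDerivAt_id (0 : ℝ)).const_mul δ).const_add h
  have h2 : HasDerivAt (fun r : ℝ => a + r) 1 0 := (hasDerivAt_id (0 : ℝ)).const_add a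
  have h3 := ((hasDerivAt_const (0 : ℝ) δ).div hs (by simp)).sub
    ((h1.mul h2).div (hs.pow 3) (by simp))
  refine h3.congr_deriv ?_
  simp
  ring

theorem heightLine_zero (h δ a : ℝ) : heightLine h δ a 0 = h := by simp [heightLine]

theorem heightLineDeriv_zero (h δ a : ℝ) : heightLineDeriv h δ a 0 = δ - h * a := by
  simp [heightLineDeriv]

theorem norm_add_smul_single (x : Sph d) (i : Fin (d + 1)) (s : ℝ) :
    ‖(x : EuclideanSpace ℝ (Fin (d + 1))) + s • EuclideanSpace.single i (1 : ℝ)‖ =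
      √(1 + 2 * (x : EuclideanSpace ℝ (Fin (d + 1))) i * s + s ^ 2) := by
  rw [← Real.sqrt_sq (norm_nonneg (_ + _)), norm_add_sq_real]
  congr 1
  simp [inner_smul_right, norm_smul, EuclideanSpace.inner_single_right]
  ring

theorem ext_zonal_line (g : ℝ → ℝ) (x : Sph d) (i : Fin (d + 1)) :
    (fun s : ℝ => ext (fun y => g (height y))
      ((x : EuclideanSpace ℝ (Fin (d + 1))) + s • EuclideanSpace.single i (1 : ℝ))) =ᶠ[𝓝 0]
    fun s => g (heightLine (height x) (if i = 0 then 1 else 0)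
      ((x : EuclideanSpace ℝ (Fin (d + 1))) i) s) := by
  have hne : ∀ᶠ y in 𝓝 (x : EuclideanSpace ℝ (Fin (d + 1))), y ≠ 0 :=
    isOpen_ne.mem_nhds (ne_zero_of_mem_unit_sphere x)
  filter_upwards [(tendsto_line (x : EuclideanSpace ℝ (Fin (d + 1)))
    (EuclideanSpace.single i (1 : ℝ))).eventually hne] with s hs
  rw [ext_of_ne _ hs]
  congr 1
  simp only [height, heightLine, norm_add_smul_single]
  simp [eq_comm, div_eq_inv_mul, mul_add]

theorem sum_heightLineDeriv_sq (x : Sph d) :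
    ∑ i : Fin (d + 1), heightLineDeriv (height x) (if i = 0 then 1 else 0)
      ((x : EuclideanSpace ℝ (Fin (d + 1))) i) 0 ^ 2 = 1 - height x ^ 2 := by
  have h : ∀ i : Fin (d + 1), heightLineDeriv (height x) (if i = 0 then 1 else 0)
      ((x : EuclideanSpace ℝ (Fin (d + 1))) i) 0 ^ 2 =
      (if i = 0 then 1 - 2 * height x * (x : EuclideanSpace ℝ (Fin (d + 1))) i else 0) +
        height x ^ 2 * (x : EuclideanSpace ℝ (Fin (d + 1))) i ^ 2 := by
    intro i
    rw [heightLineDeriv_zero]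
    split_ifs <;> ring
  rw [Finset.sum_congr rfl fun i _ => h i, Finset.sum_add_distrib, ← Finset.mul_sum, sum_sq_coord]
  simp [← height.eq_def]
  ring

theorem contMDiff_zonal {g : ℝ → ℝ} {n : WithTop ℕ∞} (hg : ContDiff ℝ n g) :
    ContMDiff (𝓡 d) 𝓘(ℝ, ℝ) n (fun x : Sph d => g (height x)) := by
  have := Fact.mk (@finrank_euclideanSpace_fin ℝ _ (d + 1))
  have h1 : ContDiff ℝ n fun y : EuclideanSpace ℝ (Fin (d + 1)) => g (y 0) :=
    hg.comp (by fun_prop)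
  exact h1.contMDiff.comp (contMDiff_coe_sphere (n := d))

/-- The operator `(1 - z²) ∂² - d z ∂`, the Laplace-Beltrami operator on functions of the
height. -/
noncomputable def zonalLaplacian (d : ℕ) : ℝ[X] →ₗ[ℝ] ℝ[X] :=
  (LinearMap.mulLeft ℝ (1 - X ^ 2)) ∘ₗ derivative ∘ₗ derivative -
    (LinearMap.mulLeft ℝ (C (d : ℝ) * X)) ∘ₗ derivative

theorem zonalLaplacian_apply (d : ℕ) (P : ℝ[X]) : zonalLaplacian d P =
    (1 - X ^ 2) * derivative (derivative P) - C (d : ℝ) * X * derivative P := rfl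

theorem contDiff_eval (P : ℝ[X]) (n : WithTop ℕ∞) : ContDiff ℝ n fun z => P.eval z := by
  simpa using P.contDiff_aeval (𝕜 := ℝ) (n := n)

/-- Second derivatives are summed over the coordinate lines through `x`. With `h` the height, the
squared slopes of the projected height add up to `1 - h²`, its second derivatives to `3h - (d+1)h -
2h = -d h`. -/
theorem laplaceBeltrami_zonal (P : ℝ[X]) (x : Sph d) :
    laplaceBeltrami (fun y => P.eval (height y)) x = (zonalLaplacian d P).eval (height x) := by
  rw [laplaceBeltrami_eq_sum
    (contDiffAt_ext (contMDiff_zonal (g := fun z => P.eval z) (contDiff_eval P 2)) x)]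
  have key : ∀ i : Fin (d + 1), deriv (deriv fun s : ℝ => ext (fun y => P.eval (height y))
      ((x : EuclideanSpace ℝ (Fin (d + 1))) + s • EuclideanSpace.single i (1 : ℝ))) 0 =
      (derivative (derivative P)).eval (height x) * heightLineDeriv (height x)
        (if i = 0 then 1 else 0) ((x : EuclideanSpace ℝ (Fin (d + 1))) i) 0 ^ 2 +
      (derivative P).eval (height x) * (3 * height x * (x : EuclideanSpace ℝ (Fin (d + 1))) i ^ 2
        - height x - if i = 0 then 2 * (x : EuclideanSpace ℝ (Fin (d + 1))) i else 0) := by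
    intro i
    rw [(ext_zonal_line (fun z => P.eval z) x i).deriv.deriv_eq]
    set δ : ℝ := if i = 0 then 1 else 0 with hδ
    set a := (x : EuclideanSpace ℝ (Fin (d + 1))) i
    have h1 : (deriv fun s => P.eval (heightLine (height x) δ a s)) =ᶠ[𝓝 0]
        fun s => (derivative P).eval (heightLine (height x) δ a s) *
          heightLineDeriv (height x) δ a s := by
      filter_upwards [eventually_line_pos a] with s hs
      exact ((P.hasDerivAt _).comp s (hasDerivAt_heightLine (height x) δ hs)).deriv
    have h2 := (((derivative P).hasDerivAt _).comp (0 : ℝ)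
      (hasDerivAt_heightLine (height x) δ (a := a) (s := 0) (by norm_num))).mul
      (hasDerivAt_heightLineDeriv (height x) δ a)
    rw [h1.deriv_eq]
    refine h2.deriv.trans ?_
    simp only [Function.comp_apply, heightLine_zero]
    rw [hδ]
    split_ifs <;> ring
  rw [Finset.sum_congr rfl fun i _ => key i, Finset.sum_add_distrib, ← Finset.mul_sum,
    ← Finset.mul_sum, sum_heightLineDeriv_sq]
  simp only [Finset.sum_sub_distrib, ← Finset.mul_sum, sum_sq_coord]
  simp [zonalLaplacian_apply, ← height.eq_def]
  ring

theorem norm_grad_zonal_sq {g : ℝ → ℝ} {g' : ℝ} {x : Sph d} (hg : HasDerivAt g g' (height x)) :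
    ‖grad (fun y => g (height y)) x‖ ^ 2 = g' ^ 2 * (1 - height x ^ 2) := by
  have hdiff : DifferentiableAt ℝ (ext fun y : Sph d => g (height y))
      (x : EuclideanSpace ℝ (Fin (d + 1))) := by
    have hx := ne_zero_of_mem_unit_sphere x
    have h1 : DifferentiableAt ℝ (fun y : EuclideanSpace ℝ (Fin (d + 1)) => ‖y‖⁻¹ * y 0) x := by
      have h2 : DifferentiableAt ℝ (fun y : EuclideanSpace ℝ (Fin (d + 1)) => ‖y‖) x :=
        (contDiffAt_norm ℝ hx (n := 1)).differentiableAt (by simp)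
      exact (h2.inv (norm_ne_zero_iff.2 hx)).mul (by fun_prop)
    have h3 : DifferentiableAt ℝ (fun y : EuclideanSpace ℝ (Fin (d + 1)) => g (‖y‖⁻¹ * y 0)) x := by
      refine DifferentiableAt.comp (g := g) (x : EuclideanSpace ℝ (Fin (d + 1))) ?_ h1
      simpa [height] using hg.differentiableAt
    refine h3.congr_of_eventuallyEq ?_
    filter_upwards [isOpen_ne.mem_nhds hx] with y hy
    rw [ext_of_ne _ hy]
    rfl
  rw [EuclideanSpace.norm_sq_eq, ← sum_heightLineDeriv_sq x, Finset.mul_sum]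
  refine Finset.sum_congr rfl fun i _ => ?_
  have h1 : grad (fun y : Sph d => g (height y)) x i =
      fderiv ℝ (ext fun y : Sph d => g (height y)) (x : EuclideanSpace ℝ (Fin (d + 1)))
        (EuclideanSpace.single i (1 : ℝ)) := by
    have h := inner_gradient_left (f := ext fun y : Sph d => g (height y))
      (x := (x : EuclideanSpace ℝ (Fin (d + 1)))) (y := EuclideanSpace.single i (1 : ℝ))
    rw [← h, EuclideanSpace.inner_single_right]
    simp [grad]
  have h2 : HasDerivAt (fun s : ℝ => ext (fun y => g (height y))
      ((x : EuclideanSpace ℝ (Fin (d + 1))) + s • EuclideanSpace.single i (1 : ℝ)))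
      (grad (fun y : Sph d => g (height y)) x i) 0 := by
    rw [h1]
    simpa using hasDerivAt_comp_line (v := EuclideanSpace.single i (1 : ℝ)) (s := 0)
      (by simpa using hdiff)
  have h3 := HasDerivAt.comp_of_eq (h₂ := g) (0 : ℝ) hg
    (hasDerivAt_heightLine (height x) (if i = 0 then 1 else 0)
      (a := (x : EuclideanSpace ℝ (Fin (d + 1))) i) (s := 0) (by norm_num)) (heightLine_zero _ _ _).symm
  rw [(h2.congr_of_eventuallyEq (ext_zonal_line g x i).symm).unique h3]
  simp [mul_pow]

/-! ### Rotation invariance and integration by parts -/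

instance isProbabilityMeasure_unif (d : ℕ) : IsProbabilityMeasure (unif d) := by
  refine ⟨?_⟩
  have h : (volume : Measure (EuclideanSpace ℝ (Fin (d + 1)))).toSphere univ ≠ 0 := by
    rw [ne_eq, Measure.measure_univ_eq_zero]
    exact Measure.toSphere_ne_zero _
  simp only [unif, Measure.smul_apply, smul_eq_mul]
  exact ENNReal.inv_mul_cancel h (measure_ne_top _ _)

theorem integrable_of_continuous {f : Sph d → ℝ} (hf : Continuous f) : Integrable f (unif d) :=
  hf.integrable_of_hasCompactSupport (HasCompactSupport.of_compactSpace f)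

/-- The action of a linear isometry on the sphere. -/
noncomputable def sphereMap (L : EuclideanSpace ℝ (Fin (d + 1)) ≃ₗᵢ[ℝ] EuclideanSpace ℝ (Fin (d + 1)))
    (x : Sph d) : Sph d := ⟨L x, by simp⟩

theorem continuous_sphereMap
    (L : EuclideanSpace ℝ (Fin (d + 1)) ≃ₗᵢ[ℝ] EuclideanSpace ℝ (Fin (d + 1))) :
    Continuous (sphereMap L) := by
  unfold sphereMap
  fun_prop

-- The surface measure of a set is a multiple of the volume of the cone over it, and linear
-- isometries carry cones to cones and preserve volume.
open scoped Pointwise in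
theorem map_sphereMap_unif
    (L : EuclideanSpace ℝ (Fin (d + 1)) ≃ₗᵢ[ℝ] EuclideanSpace ℝ (Fin (d + 1))) :
    (unif d).map (sphereMap L) = unif d := by
  have hm := (continuous_sphereMap L).measurable
  rw [unif, Measure.map_smul]
  congr 1
  refine Measure.ext fun s hs => ?_
  rw [Measure.map_apply hm hs, Measure.toSphere_apply' _ (hm hs), Measure.toSphere_apply' _ hs]
  congr 1
  have h1 : Ioo (0 : ℝ) 1 • (Subtype.val '' (sphereMap L ⁻¹' s)) =
      L ⁻¹' (Ioo (0 : ℝ) 1 • (Subtype.val '' s)) := by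
    ext y
    simp only [Set.mem_smul, mem_image, mem_preimage]
    constructor
    · rintro ⟨r, hr, _, ⟨x, hx, rfl⟩, rfl⟩
      exact ⟨r, hr, _, ⟨_, hx, rfl⟩, by simp [sphereMap]⟩
    · rintro ⟨r, hr, _, ⟨x, hx, rfl⟩, hy⟩
      refine ⟨r, hr, _, ⟨sphereMap L.symm x, ?_, rfl⟩, ?_⟩
      · simpa [sphereMap] using hx
      · apply L.injective
        simp [sphereMap, ← hy]
  rw [h1]
  exact L.measurePreserving.measure_preimage_emb L.toHomeomorph.measurableEmbedding _

theorem integral_sphereMap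
    (L : EuclideanSpace ℝ (Fin (d + 1)) ≃ₗᵢ[ℝ] EuclideanSpace ℝ (Fin (d + 1)))
    {f : Sph d → ℝ} (hf : Continuous f) :
    ∫ x, f (sphereMap L x) ∂(unif d) = ∫ x, f x ∂(unif d) := by
  conv_rhs => rw [← map_sphereMap_unif L]
  rw [integral_map (continuous_sphereMap L).aemeasurable hf.aestronglyMeasurable]

/-- The rotation by the angle `θ` in the plane of the coordinates `0` and `i`. -/
noncomputable def rot (i : Fin (d + 1)) (hi : i ≠ 0) (θ : ℝ) :
    EuclideanSpace ℝ (Fin (d + 1)) ≃ₗᵢ[ℝ] EuclideanSpace ℝ (Fin (d + 1)) :=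
  LinearIsometry.toLinearIsometryEquiv
    { toFun := fun y => y + ((Real.cos θ - 1) * y 0 - Real.sin θ * y i) •
          EuclideanSpace.single 0 (1 : ℝ) +
        (Real.sin θ * y 0 + (Real.cos θ - 1) * y i) • EuclideanSpace.single i (1 : ℝ)
      map_add' := fun y z => by
        simp only [PiLp.add_apply]
        module
      map_smul' := fun c y => by
        simp only [PiLp.smul_apply, smul_eq_mul, RingHom.id_apply]
        module
      norm_map' := fun y => by
        refine (sq_eq_sq₀ (norm_nonneg _) (norm_nonneg _)).1 ?_
        simp only [LinearMap.coe_mk, AddHom.coe_mk]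
        rw [norm_add_sq_real, norm_add_sq_real]
        simp [inner_add_left, inner_smul_left, inner_smul_right, norm_smul,
          EuclideanSpace.inner_single_right, hi]
        have := Real.sin_sq_add_cos_sq θ
        linear_combination (y 0 ^ 2 + y i ^ 2) * this }
    rfl

theorem rot_apply (i : Fin (d + 1)) (hi : i ≠ 0) (θ : ℝ) (y : EuclideanSpace ℝ (Fin (d + 1))) :
    rot i hi θ y = y + ((Real.cos θ - 1) * y 0 - Real.sin θ * y i) •
          EuclideanSpace.single 0 (1 : ℝ) +
        (Real.sin θ * y 0 + (Real.cos θ - 1) * y i) • EuclideanSpace.single i (1 : ℝ) := rfl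

theorem rot_apply_zero (i : Fin (d + 1)) (hi : i ≠ 0) (θ : ℝ)
    (y : EuclideanSpace ℝ (Fin (d + 1))) :
    rot i hi θ y 0 = Real.cos θ * y 0 - Real.sin θ * y i := by
  simp [rot_apply, hi.symm]
  ring

theorem rot_apply_self (i : Fin (d + 1)) (hi : i ≠ 0) (θ : ℝ)
    (y : EuclideanSpace ℝ (Fin (d + 1))) :
    rot i hi θ y i = Real.sin θ * y 0 + Real.cos θ * y i := by
  simp [rot_apply, hi]
  ring

theorem rot_zero (i : Fin (d + 1)) (hi : i ≠ 0) (x : Sph d) : sphereMap (rot i hi 0) x = x := by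
  ext1
  simp [sphereMap, rot_apply]

theorem continuous_zonal {h : ℝ → ℝ} (hh : ContinuousOn h (Icc (-1) 1)) :
    Continuous fun x : Sph d => h (height x) :=
  hh.comp_continuous continuous_height height_mem

/-- By rotation invariance the integral of `xᵢ h(x₀)` composed with the rotation by `θ` does not
depend on `θ`; this is its derivative at `θ = 0`. -/
theorem integral_rot_generator {h h' : ℝ → ℝ} (hd : ∀ z ∈ Icc (-1 : ℝ) 1, HasDerivAt h (h' z) z)
    (hc : ContinuousOn h' (Icc (-1) 1)) {i : Fin (d + 1)} (hi : i ≠ 0) :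
    ∫ x : Sph d, (height x * h (height x) -
      (x : EuclideanSpace ℝ (Fin (d + 1))) i ^ 2 * h' (height x)) ∂(unif d) = 0 := by
  have hch : ContinuousOn h (Icc (-1) 1) := fun z hz => (hd z hz).continuousAt.continuousWithinAt
  let F : Sph d → ℝ := fun x => (x : EuclideanSpace ℝ (Fin (d + 1))) i * h (height x)
  let G : Sph d → ℝ := fun x => height x * h (height x) -
      (x : EuclideanSpace ℝ (Fin (d + 1))) i ^ 2 * h' (height x)
  have hcoord : Continuous fun x : Sph d => (x : EuclideanSpace ℝ (Fin (d + 1))) i := by fun_prop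
  have hF : Continuous F := hcoord.mul (continuous_zonal hch)
  have hG : Continuous G := (continuous_height.mul (continuous_zonal hch)).sub
    ((hcoord.pow 2).mul (continuous_zonal hc))
  obtain ⟨M, hM⟩ := isCompact_univ.exists_bound_of_continuousOn hG.continuousOn
  have hderiv : ∀ (x : Sph d) (θ : ℝ), HasDerivAt (fun θ => F (sphereMap (rot i hi θ) x))
      (G (sphereMap (rot i hi θ) x)) θ := by
    intro x θ
    have h0 : HasDerivAt (fun θ => height (sphereMap (rot i hi θ) x))
        (-(sphereMap (rot i hi θ) x : EuclideanSpace ℝ (Fin (d + 1))) i) θ := by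
      simp only [height, sphereMap, rot_apply_zero, rot_apply_self]
      refine (((Real.hasDerivAt_cos θ).mul_const _).sub
        ((Real.hasDerivAt_sin θ).mul_const _)).congr_deriv ?_
      ring
    have h1 : HasDerivAt (fun θ => (sphereMap (rot i hi θ) x : EuclideanSpace ℝ (Fin (d + 1))) i)
        (height (sphereMap (rot i hi θ) x)) θ := by
      simp only [height, sphereMap, rot_apply_zero, rot_apply_self]
      refine (((Real.hasDerivAt_sin θ).mul_const _).add
        ((Real.hasDerivAt_cos θ).mul_const _)).congr_deriv ?_
      ring
    refine (h1.mul ((hd _ (height_mem _)).comp θ h0)).congr_deriv ?_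
    simp only [G, Function.comp_apply]
    ring
  have hint := (hasDerivAt_integral_of_dominated_loc_of_deriv_le (μ := unif d) (s := univ)
    (F := fun θ x => F (sphereMap (rot i hi θ) x))
    (F' := fun θ x => G (sphereMap (rot i hi θ) x)) (x₀ := (0 : ℝ)) (bound := fun _ => M)
    univ_mem
    (Eventually.of_forall fun θ => (hF.comp (continuous_sphereMap _)).aestronglyMeasurable)
    (integrable_of_continuous (hF.comp (continuous_sphereMap _)))
    (hG.comp (continuous_sphereMap _)).aestronglyMeasurable
    (Eventually.of_forall fun x θ _ => hM _ (mem_univ _)) (integrable_const _)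
    (Eventually.of_forall fun x θ _ => hderiv x θ)).2
  have hconst : (fun θ => ∫ x, F (sphereMap (rot i hi θ) x) ∂(unif d)) =
      fun _ => ∫ x, F x ∂(unif d) := funext fun θ => integral_sphereMap _ hF
  rw [hconst] at hint
  simp only [rot_zero] at hint
  exact hint.unique (hasDerivAt_const _ _)

/-- Integration by parts on the sphere, for functions of the height. -/
theorem integral_zonal_by_parts {h h' : ℝ → ℝ} (hd : ∀ z ∈ Icc (-1 : ℝ) 1, HasDerivAt h (h' z) z)
    (hc : ContinuousOn h' (Icc (-1) 1)) :
    ∫ x : Sph d, ((1 - height x ^ 2) * h' (height x) - d * height x * h (height x)) ∂(unif d)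
      = 0 := by
  have hch : ContinuousOn h (Icc (-1) 1) := fun z hz => (hd z hz).continuousAt.continuousWithinAt
  have hcoord : ∀ i, Continuous fun x : Sph d => (x : EuclideanSpace ℝ (Fin (d + 1))) i :=
    fun i => by fun_prop
  -- Summing the rotation identities over the `d` remaining coordinates uses `∑ xᵢ² = 1 - x₀²`.
  have h1 : ∀ x : Sph d, (1 - height x ^ 2) * h' (height x) - d * height x * h (height x) =
      -∑ j : Fin d, (height x * h (height x) -
        (x : EuclideanSpace ℝ (Fin (d + 1))) j.succ ^ 2 * h' (height x)) := by
    intro x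
    have := sum_sq_coord x
    rw [Fin.sum_univ_succ, ← height.eq_def] at this
    simp only [Finset.sum_sub_distrib, ← Finset.sum_mul, Finset.sum_const, Finset.card_univ,
      Fintype.card_fin, nsmul_eq_mul]
    linear_combination (-h' (height x)) * this
  simp_rw [h1]
  rw [integral_neg, integral_finsetSum]
  · simp [integral_rot_generator hd hc (Fin.succ_ne_zero _)]
  · intro j _
    exact integrable_of_continuous ((continuous_height.mul (continuous_zonal hch)).sub
      (((hcoord _).pow 2).mul (continuous_zonal hc)))

/-- A vanishing integral would put almost all the mass on the poles `z = ±1`. This contradicts `∫ (1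
- (d+1) z²) = 0`, the integration by parts for `h(z) = z`, since the integrand equals `-d` at the
poles. -/
theorem integral_zonal_pos (hd : 0 < d) {g : ℝ → ℝ} (hg : ContinuousOn g (Icc (-1) 1))
    (hpos : ∀ z ∈ Ioo (-1 : ℝ) 1, 0 < g z) : 0 < ∫ x : Sph d, g (height x) ∂(unif d) := by
  have hnn : ∀ z ∈ Icc (-1 : ℝ) 1, 0 ≤ g z := by
    have h : Icc (-1 : ℝ) 1 = closure (Ioo (-1) 1) := (closure_Ioo (by norm_num)).symm
    intro z hz
    have hle := closure_minimal (s := Ioo (-1 : ℝ) 1) (t := Icc (-1) 1 ∩ g ⁻¹' Ici 0)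
      (fun y hy => ⟨Ioo_subset_Icc_self hy, (hpos y hy).le⟩)
      (hg.preimage_isClosed_of_isClosed isClosed_Icc isClosed_Ici)
    exact (hle (h ▸ hz)).2
  have hint : Integrable (fun x : Sph d => g (height x)) (unif d) :=
    integrable_of_continuous (continuous_zonal hg)
  refine (integral_nonneg fun x => hnn _ (height_mem x)).lt_of_ne fun h0 => ?_
  have hae := (integral_eq_zero_iff_of_nonneg (fun x => hnn _ (height_mem x)) hint).1 h0.symm
  have hsq : ∀ᵐ x : Sph d ∂(unif d), height x ^ 2 = 1 := by
    filter_upwards [hae] with x hx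
    by_contra hne
    have hm := height_mem x
    have : height x ∈ Ioo (-1 : ℝ) 1 := by
      constructor
      · exact hm.1.lt_of_ne fun h => hne (by rw [← h]; norm_num)
      · exact hm.2.lt_of_ne fun h => hne (by rw [h]; norm_num)
    exact (hpos _ this).ne' hx
  have hibp := integral_zonal_by_parts (d := d) (h := fun z => z) (h' := fun _ => 1)
    (fun z _ => hasDerivAt_id z) continuousOn_const
  have hcongr : ∀ᵐ x : Sph d ∂(unif d),
      (1 - height x ^ 2) * (1 : ℝ) - d * height x * height x = -(d : ℝ) := by
    filter_upwards [hsq] with x hx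
    linear_combination (-(d : ℝ) - 1) * hx
  rw [integral_congr_ae hcongr] at hibp
  simp at hibp
  omega

/-! ### Spectral decomposition of polynomials and the explicit heat flow -/

theorem coeff_zonalLaplacian (d : ℕ) (P : ℝ[X]) (m : ℕ) : (zonalLaplacian d P).coeff m =
    (m + 2) * (m + 1) * P.coeff (m + 2) - m * (m + d - 1) * P.coeff m := by
  rw [zonalLaplacian_apply, sub_mul, one_mul, mul_assoc]
  rcases m with _ | _ | m
  · simp [coeff_derivative]
    ring
  · simp [coeff_X_pow_mul', coeff_derivative, coeff_X_mul]
    ring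
  · simp [coeff_X_pow_mul', coeff_derivative, coeff_X_mul]
    ring

/-- The opposite of the `k`-th eigenvalue of `zonalLaplacian d`. -/
def eigenvalue (d k : ℕ) : ℝ := k * (k + d - 1)

theorem eigenvalue_lt (hd : 1 ≤ d) {k n : ℕ} (h : k < n) : eigenvalue d k < eigenvalue d n := by
  have h1 : (k : ℝ) + 1 ≤ n := by exact_mod_cast h
  have h2 : (1 : ℝ) ≤ d := by exact_mod_cast hd
  have h3 : (0 : ℝ) ≤ k := k.cast_nonneg
  unfold eigenvalue
  nlinarith

/-- On degree at most `n`, the operator `L + λₙ` kills the coefficient of `zⁿ`, so induction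
decomposes `(L + λₙ)P`. Dividing its components by `λₙ - λₖ ≠ 0` gives `S` with the same image as
`P`, and `P - S` is the missing eigenvector. -/
theorem exists_eigenvector_decomposition (hd : 1 ≤ d) (n : ℕ) (P : ℝ[X])
    (hP : ∀ m, n ≤ m → P.coeff m = 0) : ∃ H : ℕ → ℝ[X], P = ∑ k ∈ Finset.range n, H k ∧
      ∀ k ∈ Finset.range n, zonalLaplacian d (H k) = -eigenvalue d k • H k := by
  induction n generalizing P with
  | zero => exact ⟨0, by ext m; simp [hP m], by simp⟩
  | succ n ih =>
    obtain ⟨H, hR, hH⟩ := ih (zonalLaplacian d P + eigenvalue d n • P) (fun m hm => by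
      rw [coeff_add, coeff_zonalLaplacian, coeff_smul, hP (m + 2) (by omega)]
      rcases hm.eq_or_lt with rfl | hlt
      · simp [eigenvalue]
      · simp [hP m hlt])
    set S : ℝ[X] := ∑ k ∈ Finset.range n, (eigenvalue d n - eigenvalue d k)⁻¹ • H k with hS
    have hLS : zonalLaplacian d S + eigenvalue d n • S =
        zonalLaplacian d P + eigenvalue d n • P := by
      rw [hR, hS, map_sum, Finset.smul_sum, ← Finset.sum_add_distrib]
      refine Finset.sum_congr rfl fun k hk => ?_
      have hne : eigenvalue d n - eigenvalue d k ≠ 0 :=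
        (sub_pos.2 (eigenvalue_lt hd (Finset.mem_range.1 hk))).ne'
      rw [map_smul, hH k hk, smul_smul, smul_smul, ← add_smul]
      have : (eigenvalue d n - eigenvalue d k)⁻¹ * -eigenvalue d k +
          eigenvalue d n * (eigenvalue d n - eigenvalue d k)⁻¹ = 1 := by
        field_simp
        ring
      rw [this, one_smul]
    refine ⟨fun k => if k = n then P - S else (eigenvalue d n - eigenvalue d k)⁻¹ • H k, ?_, ?_⟩
    · rw [Finset.sum_range_succ, if_pos rfl]
      have : ∑ k ∈ Finset.range n, (if k = n then P - S else
          (eigenvalue d n - eigenvalue d k)⁻¹ • H k) = S :=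
        Finset.sum_congr rfl fun k hk => if_neg (Finset.mem_range.1 hk).ne
      rw [this]
      ring
    · intro k hk
      beta_reduce
      split_ifs with h
      · subst h
        rw [map_sub, neg_smul, smul_sub]
        linear_combination -hLS
      · have hk' : k ∈ Finset.range n := by
          rw [Finset.mem_range] at hk ⊢
          omega
        rw [map_smul, hH k hk', smul_comm]

/-- The flow is `∑ exp(-λₖ t) Hₖ`. It is a finite sum and exists for negative times too, so
two-sided derivatives at `t = 0` make sense. The arbitrary linear map `A` covers `ρ`, `ρ'`, `Lρ` and
`(Lρ)'` at once. -/
theorem exists_zonal_heat_flow (hd : 1 ≤ d) (P : ℝ[X]) : ∃ Q : ℝ → ℝ[X], Q 0 = P ∧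
    (∀ A : ℝ[X] →ₗ[ℝ] ℝ[X], Continuous fun q : ℝ × ℝ => (A (Q q.1)).eval q.2) ∧
    ∀ (A : ℝ[X] →ₗ[ℝ] ℝ[X]) (t z : ℝ),
      HasDerivAt (fun s => (A (Q s)).eval z) ((A (zonalLaplacian d (Q t))).eval z) t := by
  obtain ⟨H, hsum, hH⟩ := exists_eigenvector_decomposition hd (P.natDegree + 1) P
    (fun m hm => coeff_eq_zero_of_natDegree_lt hm)
  refine ⟨fun t => ∑ k ∈ Finset.range (P.natDegree + 1), Real.exp (-eigenvalue d k * t) • H k,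
    by simp [← hsum], fun A => ?_, fun A t z => ?_⟩
  · simp only [map_sum, map_smul, eval_finsetSum, eval_smul, smul_eq_mul]
    refine continuous_finsetSum _ fun k _ => ?_
    have : Continuous fun q : ℝ × ℝ => (A (H k)).eval q.2 :=
      (A (H k)).continuous.comp continuous_snd
    fun_prop
  · simp only [map_sum, map_smul, eval_finsetSum, eval_smul, smul_eq_mul]
    refine HasDerivAt.fun_sum fun k hk => ?_
    rw [hH k hk]
    have h1 : HasDerivAt (fun s => Real.exp (-eigenvalue d k * s))
        (Real.exp (-eigenvalue d k * t) * -eigenvalue d k) t := by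
      simpa using ((hasDerivAt_id t).const_mul (-eigenvalue d k)).exp
    refine (h1.mul_const _).congr_deriv ?_
    simp
    ring

theorem isHeatSolution_zonal {Q : ℝ → ℝ[X]}
    (hc : Continuous fun q : ℝ × ℝ => (Q q.1).eval q.2)
    (hQ : ∀ t z, HasDerivAt (fun s => (Q s).eval z) ((zonalLaplacian d (Q t)).eval z) t) :
    IsHeatSolution (fun x : Sph d => (Q 0).eval (height x)) fun t x => (Q t).eval (height x) where
  continuousOn := by
    have h : Continuous fun q : ℝ × Sph d => (q.1, height q.2) :=
      continuous_fst.prodMk (continuous_height.comp continuous_snd)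
    exact (hc.comp h).continuousOn
  contMDiff t _ := contMDiff_zonal (contDiff_eval (Q t) 2)
  equation t _ x := by
    rw [laplaceBeltrami_zonal]
    exact hQ t _
  initial x := rfl

/-! ### Time derivatives of the Fisher information and of the entropy -/

theorem hasDerivAt_integral_zonal {G G' : ℝ → ℝ → ℝ} {ε : ℝ} (hε : 0 < ε)
    (hG : ∀ t ∈ Icc (-ε) ε, ∀ z ∈ Icc (-1 : ℝ) 1, HasDerivAt (fun s => G s z) (G' t z) t)
    (hGc : ∀ t ∈ Icc (-ε) ε, ContinuousOn (G t) (Icc (-1) 1))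
    (hG'c : ContinuousOn (fun q : ℝ × ℝ => G' q.1 q.2) (Icc (-ε) ε ×ˢ Icc (-1) 1)) :
    HasDerivAt (fun t => ∫ x : Sph d, G t (height x) ∂(unif d))
      (∫ x : Sph d, G' 0 (height x) ∂(unif d)) 0 := by
  obtain ⟨M, hM⟩ := (isCompact_Icc.prod isCompact_Icc).exists_bound_of_continuousOn hG'c
  have h0 : (0 : ℝ) ∈ Icc (-ε) ε := ⟨by linarith, hε.le⟩
  have hnhds : Icc (-ε) ε ∈ 𝓝 (0 : ℝ) := Icc_mem_nhds (by linarith) hε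
  have hG'0 : ContinuousOn (G' 0) (Icc (-1) 1) :=
    hG'c.comp (f := fun z : ℝ => ((0 : ℝ), z)) (by fun_prop) fun z hz => ⟨h0, hz⟩
  refine (hasDerivAt_integral_of_dominated_loc_of_deriv_le (μ := unif d) (s := Icc (-ε) ε)
    (F := fun t x => G t (height x)) (F' := fun t x => G' t (height x)) (x₀ := (0 : ℝ))
    (bound := fun _ => M) hnhds ?_ (integrable_of_continuous (continuous_zonal (hGc 0 h0)))
    (continuous_zonal hG'0).aestronglyMeasurable ?_ (integrable_const _) ?_).2
  · filter_upwards [hnhds] with t ht using (continuous_zonal (hGc t ht)).aestronglyMeasurable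
  · exact Eventually.of_forall fun x t ht => hM (t, height x) ⟨ht, height_mem x⟩
  · exact Eventually.of_forall fun x t ht => hG t ht _ (height_mem x)

theorem rpow_zonal_sq {p r : ℝ} (hr : 0 < r) :
    (r ^ (1 / p - 1)) ^ 2 = r ^ (2 / p) / r ^ 2 := by
  rw [← Real.rpow_natCast, ← Real.rpow_mul hr.le, ← Real.rpow_natCast r 2, ← Real.rpow_sub hr]
  congr 1
  push_cast
  ring

theorem fisher_zonal {p : ℝ} {P : ℝ[X]} (hP : ∀ z ∈ Icc (-1 : ℝ) 1, 0 < P.eval z) :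
    fisher p (fun x : Sph d => P.eval (height x)) =
      ∫ x : Sph d, 1 / p ^ 2 * (P.eval (height x) ^ (2 / p) *
        ((derivative P).eval (height x) / P.eval (height x)) ^ 2 * (1 - height x ^ 2))
        ∂(unif d) := by
  refine integral_congr_ae (Eventually.of_forall fun x => ?_)
  have hpos := hP _ (height_mem x)
  have h := (P.hasDerivAt (height x)).rpow_const (p := 1 / p) (Or.inl hpos.ne')
  beta_reduce
  rw [norm_grad_zonal_sq (g := fun z => P.eval z ^ (1 / p)) h, mul_pow, mul_pow,
    rpow_zonal_sq hpos]
  ring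

/-- The integrand of the time derivative of the Fisher information along the heat flow, in terms
of the weight `w = ρ ^ (2 / p)` and the quotients `a = ρ' / ρ`, `l = Lρ / ρ`, `m = (Lρ)' / ρ`. -/
noncomputable def fisherRate (p z w a l m : ℝ) : ℝ :=
  1 / p ^ 2 * ((2 / p * w * l * a ^ 2 + w * (2 * a * (m - a * l))) * (1 - z ^ 2))

theorem continuousOn_fisherRate {X : Type*} [TopologicalSpace X] {s : Set X} (p : ℝ)
    {z w a l m : X → ℝ} (hz : ContinuousOn z s) (hw : ContinuousOn w s) (ha : ContinuousOn a s)
    (hl : ContinuousOn l s) (hm : ContinuousOn m s) :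
    ContinuousOn (fun x => fisherRate p (z x) (w x) (a x) (l x) (m x)) s := by
  unfold fisherRate
  fun_prop

theorem hasDerivAt_rpow_pos {r : ℝ → ℝ} {r' t q : ℝ} (h : HasDerivAt r r' t) (hr : 0 < r t) :
    HasDerivAt (fun s => r s ^ q) (q * r t ^ q * (r' / r t)) t := by
  refine (h.rpow_const (p := q) (Or.inl hr.ne')).congr_deriv ?_
  rw [Real.rpow_sub_one hr.ne']
  ring

/-- Compactness of `[-1, 1]` makes positivity persist for a uniform time in both directions, which
keeps the real powers and quotients differentiable. -/
theorem exists_pos_near {Q : ℝ → ℝ[X]} (hc : Continuous fun q : ℝ × ℝ => (Q q.1).eval q.2)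
    (hpos : ∀ z ∈ Icc (-1 : ℝ) 1, 0 < (Q 0).eval z) :
    ∃ ε > 0, ∀ t ∈ Icc (-ε) ε, ∀ z ∈ Icc (-1 : ℝ) 1, 0 < (Q t).eval z := by
  have h : ∀ᶠ t in 𝓝 (0 : ℝ), ∀ z ∈ Icc (-1 : ℝ) 1, 0 < (Q t).eval z :=
    isCompact_Icc.eventually_forall_of_forall_eventually fun z hz =>
      hc.continuousAt.eventually (lt_mem_nhds (hpos z hz))
  obtain ⟨ε, hε, hb⟩ := Metric.eventually_nhds_iff.1 h
  refine ⟨ε / 2, by positivity, fun t ht => hb ?_⟩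
  rw [Real.dist_0_eq_abs, abs_lt]
  constructor <;> linarith [ht.1, ht.2]

theorem hasDerivAt_fisher_flow {p : ℝ} {Q : ℝ → ℝ[X]}
    (hc : ∀ A : ℝ[X] →ₗ[ℝ] ℝ[X], Continuous fun q : ℝ × ℝ => (A (Q q.1)).eval q.2)
    (hQ : ∀ (A : ℝ[X] →ₗ[ℝ] ℝ[X]) (t z : ℝ),
      HasDerivAt (fun s => (A (Q s)).eval z) ((A (zonalLaplacian d (Q t))).eval z) t)
    (hpos : ∀ z ∈ Icc (-1 : ℝ) 1, 0 < (Q 0).eval z) :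
    HasDerivAt (fun t => fisher p (fun x : Sph d => (Q t).eval (height x)))
      (∫ x : Sph d, fisherRate p (height x) ((Q 0).eval (height x) ^ (2 / p))
        ((derivative (Q 0)).eval (height x) / (Q 0).eval (height x))
        ((zonalLaplacian d (Q 0)).eval (height x) / (Q 0).eval (height x))
        ((derivative (zonalLaplacian d (Q 0))).eval (height x) / (Q 0).eval (height x))
        ∂(unif d)) 0 := by
  obtain ⟨ε, hε, hp⟩ := exists_pos_near (hc LinearMap.id) hpos
  have hnhds : Icc (-ε) ε ∈ 𝓝 (0 : ℝ) := Icc_mem_nhds (by linarith) hε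
  refine HasDerivAt.congr_of_eventuallyEq ?_
    (eventually_of_mem hnhds fun t ht => fisher_zonal (hp t ht))
  refine hasDerivAt_integral_zonal
    (G := fun t z => 1 / p ^ 2 * ((Q t).eval z ^ (2 / p) *
        ((derivative (Q t)).eval z / (Q t).eval z) ^ 2 * (1 - z ^ 2)))
    (G' := fun t z => fisherRate p z ((Q t).eval z ^ (2 / p))
        ((derivative (Q t)).eval z / (Q t).eval z)
        ((zonalLaplacian d (Q t)).eval z / (Q t).eval z)
        ((derivative (zonalLaplacian d (Q t))).eval z / (Q t).eval z)) hε ?_ ?_ ?_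
  · intro t ht z hz
    have hr := (hp t ht z hz)
    have h0 := hQ LinearMap.id t z
    have h1 := hQ derivative t z
    simp only [LinearMap.id_apply] at h0
    have h2 : HasDerivAt (fun s => (derivative (Q s)).eval z / (Q s).eval z)
        ((derivative (zonalLaplacian d (Q t))).eval z / (Q t).eval z -
          (derivative (Q t)).eval z / (Q t).eval z *
            ((zonalLaplacian d (Q t)).eval z / (Q t).eval z)) t := by
      refine (h1.div h0 hr.ne').congr_deriv ?_
      have := hr.ne'
      field_simp
    refine ((((hasDerivAt_rpow_pos (q := 2 / p) h0 hr).mul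
      (h2.pow 2)).mul_const (1 - z ^ 2)).const_mul (1 / p ^ 2)).congr_deriv ?_
    simp only [fisherRate, Pi.pow_apply]
    ring
  · intro t ht
    have hr : ∀ z ∈ Icc (-1 : ℝ) 1, (Q t).eval z ≠ 0 := fun z hz => (hp t ht z hz).ne'
    have h0 : ContinuousOn (fun z => (Q t).eval z) (Icc (-1) 1) := (Q t).continuous.continuousOn
    have h1 : ContinuousOn (fun z => (derivative (Q t)).eval z) (Icc (-1) 1) :=
      (derivative (Q t)).continuous.continuousOn
    have hw := h0.rpow_const (p := 2 / p) fun z hz => Or.inl (hr z hz)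
    have ha := h1.div h0 hr
    fun_prop
  · have hr : ∀ q ∈ Icc (-ε) ε ×ˢ Icc (-1 : ℝ) 1, (Q q.1).eval q.2 ≠ 0 :=
      fun q hq => (hp q.1 hq.1 q.2 hq.2).ne'
    have h0 := (hc LinearMap.id).continuousOn (s := Icc (-ε) ε ×ˢ Icc (-1 : ℝ) 1)
    simp only [LinearMap.id_apply] at h0
    have hw := h0.rpow_const (p := 2 / p) fun q hq => Or.inl (hr q hq)
    have ha := (hc derivative).continuousOn.div h0 hr
    have hl := (hc (zonalLaplacian d)).continuousOn.div h0 hr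
    have hm := (hc (derivative ∘ₗ zonalLaplacian d)).continuousOn.div h0 hr
    simp only [LinearMap.comp_apply] at hm
    exact continuousOn_fisherRate p (by fun_prop) hw ha hl hm

theorem integral_zonalLaplacian (d : ℕ) (P : ℝ[X]) :
    ∫ x : Sph d, (zonalLaplacian d P).eval (height x) ∂(unif d) = 0 := by
  rw [← integral_zonal_by_parts (d := d) (h := fun z => (derivative P).eval z)
    (h' := fun z => (derivative (derivative P)).eval z) (fun z _ => (derivative P).hasDerivAt z)
    (derivative (derivative P)).continuous.continuousOn]
  simp [zonalLaplacian_apply]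

theorem hasDerivAt_entropy_flow {p : ℝ} {Q : ℝ → ℝ[X]}
    (hc : ∀ A : ℝ[X] →ₗ[ℝ] ℝ[X], Continuous fun q : ℝ × ℝ => (A (Q q.1)).eval q.2)
    (hQ : ∀ (A : ℝ[X] →ₗ[ℝ] ℝ[X]) (t z : ℝ),
      HasDerivAt (fun s => (A (Q s)).eval z) ((A (zonalLaplacian d (Q t))).eval z) t)
    (hpos : ∀ z ∈ Icc (-1 : ℝ) 1, 0 < (Q 0).eval z) :
    HasDerivAt (fun t => entropy p (fun x : Sph d => (Q t).eval (height x)))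
      (-(1 / (p - 2)) * ∫ x : Sph d, 2 / p * (Q 0).eval (height x) ^ (2 / p) *
        ((zonalLaplacian d (Q 0)).eval (height x) / (Q 0).eval (height x)) ∂(unif d)) 0 := by
  obtain ⟨ε, hε, hp⟩ := exists_pos_near (hc LinearMap.id) hpos
  have hcz : ∀ t, ContinuousOn (fun z => (Q t).eval z) (Icc (-1) 1) :=
    fun t => (Q t).continuous.continuousOn
  -- Conservation of mass: only the integral of `ρ^(2/p)` contributes to the derivative of the
  -- entropy.
  have hmass : HasDerivAt (fun t => ∫ x : Sph d, (Q t).eval (height x) ∂(unif d)) 0 0 := by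
    refine (hasDerivAt_integral_zonal (G := fun t z => (Q t).eval z)
      (G' := fun t z => (zonalLaplacian d (Q t)).eval z) hε
      (fun t _ z _ => hQ LinearMap.id t z) (fun t _ => hcz t)
      (hc (zonalLaplacian d)).continuousOn).congr_deriv (integral_zonalLaplacian d (Q 0))
  have hmass_pos : 0 < ∫ x : Sph d, (Q 0).eval (height x) ∂(unif d) := by
    obtain ⟨z₀, hz₀, hmin⟩ := isCompact_Icc.exists_isMinOn
      (nonempty_Icc.2 (by norm_num : (-1 : ℝ) ≤ 1)) (hcz 0)
    have h := integral_mono (μ := unif d) (integrable_const ((Q 0).eval z₀))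
      (integrable_of_continuous (continuous_zonal (hcz 0))) fun x => hmin (height_mem x)
    simp only [integral_const, probReal_univ, one_smul] at h
    exact (hpos z₀ hz₀).trans_le h
  have hpow : HasDerivAt (fun t => ∫ x : Sph d, (Q t).eval (height x) ^ (2 / p) ∂(unif d))
      (∫ x : Sph d, 2 / p * (Q 0).eval (height x) ^ (2 / p) *
        ((zonalLaplacian d (Q 0)).eval (height x) / (Q 0).eval (height x)) ∂(unif d)) 0 := by
    refine hasDerivAt_integral_zonal (G := fun t z => (Q t).eval z ^ (2 / p))
      (G' := fun t z => 2 / p * (Q t).eval z ^ (2 / p) *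
        ((zonalLaplacian d (Q t)).eval z / (Q t).eval z)) hε ?_ ?_ ?_
    · intro t ht z hz
      exact hasDerivAt_rpow_pos (hQ LinearMap.id t z) (hp t ht z hz)
    · exact fun t ht => (hcz t).rpow_const fun z hz => Or.inl (hp t ht z hz).ne'
    · have hr : ∀ q ∈ Icc (-ε) ε ×ˢ Icc (-1 : ℝ) 1, (Q q.1).eval q.2 ≠ 0 :=
        fun q hq => (hp q.1 hq.1 q.2 hq.2).ne'
      have h0 := (hc LinearMap.id).continuousOn (s := Icc (-ε) ε ×ˢ Icc (-1 : ℝ) 1)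
      simp only [LinearMap.id_apply] at h0
      have hw := h0.rpow_const (p := 2 / p) fun q hq => Or.inl (hr q hq)
      have hl := (hc (zonalLaplacian d)).continuousOn.div h0 hr
      exact (continuousOn_const.mul hw).mul hl
  have h := ((hasDerivAt_rpow_pos (q := 2 / p) hmass hmass_pos).sub hpow).const_mul (1 / (p - 2))
  refine h.congr_deriv ?_
  ring

/-! ### The derivative as the integral of a quadratic form -/

/-- The density, with respect to `ρ ^ (2 / p) (1 - z²)²`, of the time derivative of
`fisher p ρ - d * entropy p ρ` along the heat flow, as a function of `a = ρ' / ρ`,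
`b = ρ'' / ρ`. -/
noncomputable def deficitRate (d : ℕ) (p a b : ℝ) : ℝ :=
  -2 * ((b / p + 1 / p * (1 / p - 1) * a ^ 2) ^ 2 -
    2 * ((p - 1) * (d - 1) / (d + 2)) * (a ^ 2 / p ^ 2) * (b / p + 1 / p * (1 / p - 1) * a ^ 2) +
    (p - 1) * d / (d + 2) * (a ^ 4 / p ^ 4))

/-- The two integrands differ by an exact term `(1 - z²) h' - d z h`, whose integral vanishes. -/
theorem integral_rate_eq {p : ℝ} (hp : 2 < p) {P : ℝ[X]}
    (hP : ∀ z ∈ Icc (-1 : ℝ) 1, 0 < P.eval z) :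
    (∫ x : Sph d, fisherRate p (height x) (P.eval (height x) ^ (2 / p))
        ((derivative P).eval (height x) / P.eval (height x))
        ((zonalLaplacian d P).eval (height x) / P.eval (height x))
        ((derivative (zonalLaplacian d P)).eval (height x) / P.eval (height x)) ∂(unif d)) -
      d * (-(1 / (p - 2)) * ∫ x : Sph d, 2 / p * P.eval (height x) ^ (2 / p) *
        ((zonalLaplacian d P).eval (height x) / P.eval (height x)) ∂(unif d)) =
    ∫ x : Sph d, P.eval (height x) ^ (2 / p) * (1 - height x ^ 2) ^ 2 *
      deficitRate d p ((derivative P).eval (height x) / P.eval (height x))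
        ((derivative (derivative P)).eval (height x) / P.eval (height x)) ∂(unif d) := by
  have hr : ∀ z ∈ Icc (-1 : ℝ) 1, P.eval z ≠ 0 := fun z hz => (hP z hz).ne'
  have hcP : ∀ R : ℝ[X], ContinuousOn (fun z => R.eval z) (Icc (-1) 1) :=
    fun R => R.continuous.continuousOn
  have hw := (hcP P).rpow_const (p := 2 / p) fun z hz => Or.inl (hr z hz)
  have hq : ∀ R : ℝ[X], ContinuousOn (fun z => R.eval z / P.eval z) (Icc (-1) 1) :=
    fun R => (hcP R).div (hcP P) hr
  have ha := hq (derivative P)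
  have hb := hq (derivative (derivative P))
  have he := hq (derivative (derivative (derivative P)))
  have hl := hq (zonalLaplacian d P)
  have hm := hq (derivative (zonalLaplacian d P))
  set w : ℝ → ℝ := fun z => P.eval z ^ (2 / p) with hw_def
  set a : ℝ → ℝ := fun z => (derivative P).eval z / P.eval z with ha_def
  set b : ℝ → ℝ := fun z => (derivative (derivative P)).eval z / P.eval z with hb_def
  set e : ℝ → ℝ := fun z => (derivative (derivative (derivative P))).eval z / P.eval z with he_def
  set l : ℝ → ℝ := fun z => (zonalLaplacian d P).eval z / P.eval z with hl_def
  set m : ℝ → ℝ := fun z => (derivative (zonalLaplacian d P)).eval z / P.eval z with hm_def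
  have hwd : ∀ z ∈ Icc (-1 : ℝ) 1, HasDerivAt w (2 / p * w z * a z) z :=
    fun z hz => hasDerivAt_rpow_pos (P.hasDerivAt z) (hP z hz)
  have hquot : ∀ (R : ℝ[X]), ∀ z ∈ Icc (-1 : ℝ) 1, HasDerivAt (fun z => R.eval z / P.eval z)
      ((derivative R).eval z / P.eval z - R.eval z / P.eval z * a z) z := by
    intro R z hz
    refine ((R.hasDerivAt z).div (P.hasDerivAt z) (hr z hz)).congr_deriv ?_
    have := hr z hz
    simp only [ha_def]
    field_simp
  have had : ∀ z ∈ Icc (-1 : ℝ) 1, HasDerivAt a (b z - a z * a z) z := hquot (derivative P)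
  have hbd : ∀ z ∈ Icc (-1 : ℝ) 1, HasDerivAt b (e z - b z * a z) z :=
    hquot (derivative (derivative P))
  have hl_eq : ∀ z ∈ Icc (-1 : ℝ) 1, l z = (1 - z ^ 2) * b z - d * z * a z := by
    intro z hz
    have := hr z hz
    simp only [hl_def, ha_def, hb_def, zonalLaplacian_apply]
    simp
    field_simp
  have hm_eq : ∀ z ∈ Icc (-1 : ℝ) 1,
      m z = (1 - z ^ 2) * e z - 2 * z * b z - d * a z - d * z * b z := by
    intro z hz
    have := hr z hz
    simp only [hm_def, ha_def, hb_def, he_def, zonalLaplacian_apply]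
    simp
    field_simp
    ring
  -- The constants are found by matching terms: `α` removes the third derivative `e`, `β` the term
  -- in `z a³`, and `δ` the entropy term. The same `δ` also cancels the remaining `a²` term, which
  -- is where the factor `d` in front of the entropy is needed.
  set α : ℝ := 2 / p ^ 2 with hα
  set β : ℝ := 2 * d * (1 - p) / ((d + 2) * p ^ 3) with hβ
  set δ : ℝ := 2 * d / (p * (p - 2)) with hδ
  set h : ℝ → ℝ := fun z => w z * ((1 - z ^ 2) * (α * (a z * b z) + β * a z ^ 3) + δ * a z)
    with hh
  set h' : ℝ → ℝ := fun z => 2 / p * w z * a z *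
      ((1 - z ^ 2) * (α * (a z * b z) + β * a z ^ 3) + δ * a z) +
    w z * (-(2 * z) * (α * (a z * b z) + β * a z ^ 3) +
      (1 - z ^ 2) * (α * ((b z - a z * a z) * b z + a z * (e z - b z * a z)) +
        β * (3 * a z ^ 2 * (b z - a z * a z))) + δ * (b z - a z * a z)) with hh'
  have hhd : ∀ z ∈ Icc (-1 : ℝ) 1, HasDerivAt h (h' z) z := by
    intro z hz
    have hv : HasDerivAt (fun z : ℝ => 1 - z ^ 2) (-(2 * z)) z := by
      simpa using ((hasDerivAt_id z).pow 2).const_sub 1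
    refine ((hwd z hz).mul ((hv.mul ((((had z hz).mul (hbd z hz)).const_mul α).add
      (((had z hz).pow 3).const_mul β))).add ((had z hz).const_mul δ))).congr_deriv ?_
    simp only [hh', Pi.mul_apply, Pi.add_apply, Pi.pow_apply]
    norm_num
  have hh'c : ContinuousOn h' (Icc (-1) 1) := by
    simp only [hh']
    fun_prop
  have hibp := integral_zonal_by_parts (d := d) hhd hh'c
  have hint : ∀ {g : ℝ → ℝ}, ContinuousOn g (Icc (-1) 1) →
      Integrable (fun x : Sph d => g (height x)) (unif d) :=
    fun hg => integrable_of_continuous (continuous_zonal hg)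
  have hi1 := hint (g := fun z => fisherRate p z (w z) (a z) (l z) (m z)) (
    continuousOn_fisherRate p continuousOn_id hw ha hl hm)
  have hi2 := hint (g := fun z => 2 / p * w z * l z) (by fun_prop)
  have hi3 := hint (g := fun z => w z * (1 - z ^ 2) ^ 2 * deficitRate d p (a z) (b z)) (by
    unfold deficitRate
    fun_prop)
  have hpt : ∀ z ∈ Icc (-1 : ℝ) 1, fisherRate p z (w z) (a z) (l z) (m z) +
      d / (p - 2) * (2 / p * w z * l z) - w z * (1 - z ^ 2) ^ 2 * deficitRate d p (a z) (b z) =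
      (1 - z ^ 2) * h' z - d * z * h z := by
    intro z hz
    have hp0 : p ≠ 0 := by linarith
    have hp2 : p - 2 ≠ 0 := by linarith
    have hd2 : (d : ℝ) + 2 ≠ 0 := by positivity
    rw [hl_eq z hz, hm_eq z hz]
    simp only [hh, hh', hα, hβ, hδ, fisherRate, deficitRate]
    generalize w z = w, a z = a, b z = b, e z = e
    field_simp
    ring
  have hsum : ∫ x : Sph d, (fisherRate p (height x) (w (height x)) (a (height x)) (l (height x))
      (m (height x)) + d / (p - 2) * (2 / p * w (height x) * l (height x)) -
      w (height x) * (1 - height x ^ 2) ^ 2 * deficitRate d p (a (height x)) (b (height x)))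
      ∂(unif d) = 0 := by
    rw [← hibp]
    exact integral_congr_ae (Eventually.of_forall fun x => hpt _ (height_mem x))
  have hi4 : Integrable (fun x : Sph d => fisherRate p (height x) (w (height x)) (a (height x))
      (l (height x)) (m (height x)) + d / (p - 2) * (2 / p * w (height x) * l (height x)))
      (unif d) := hi1.add (hi2.const_mul _)
  rw [integral_sub hi4 hi3, integral_add hi1 (hi2.const_mul _),
    integral_const_mul] at hsum
  linear_combination hsum

/-! ### Approximation by polynomials in `C²` -/

theorem exists_antiderivative (q : ℝ[X]) (c : ℝ) :
    ∃ Q : ℝ[X], derivative Q = q ∧ Q.eval 0 = c := by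
  have h : ∃ Q : ℝ[X], derivative Q = q := by
    induction q using Polynomial.induction_on' with
    | add p q hp hq =>
      obtain ⟨P, rfl⟩ := hp
      obtain ⟨Q, rfl⟩ := hq
      exact ⟨P + Q, derivative_add⟩
    | monomial n a =>
      refine ⟨monomial (n + 1) (a / (n + 1)), ?_⟩
      rw [derivative_monomial]
      congr 1
      push_cast
      field_simp
  obtain ⟨Q, hQ⟩ := h
  exact ⟨Q + C (c - Q.eval 0), by simp [hQ], by simp⟩

theorem abs_eval_sub_le {f f' : ℝ → ℝ} (hf : ∀ z ∈ Icc (-1 : ℝ) 1, HasDerivAt f (f' z) z)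
    {Q : ℝ[X]} {ε : ℝ} (h0 : Q.eval 0 = f 0)
    (hQ : ∀ z ∈ Icc (-1 : ℝ) 1, |(derivative Q).eval z - f' z| ≤ ε) {z : ℝ}
    (hz : z ∈ Icc (-1 : ℝ) 1) : |Q.eval z - f z| ≤ ε := by
  have h := (convex_Icc (-1 : ℝ) 1).norm_image_sub_le_of_norm_hasDerivWithin_le
    (f := fun z => Q.eval z - f z) (f' := fun z => (derivative Q).eval z - f' z)
    (fun y hy => ((Q.hasDerivAt y).sub (hf y hy)).hasDerivWithinAt) hQ
    (by norm_num : (0 : ℝ) ∈ Icc (-1 : ℝ) 1) hz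
  simp only [h0, sub_self, sub_zero, Real.norm_eq_abs] at h
  have hε : 0 ≤ ε := (abs_nonneg _).trans (hQ z hz)
  exact h.trans (mul_le_of_le_one_right hε (abs_le.2 hz))

/-- Weierstrass approximation of a function together with its first two derivatives. -/
theorem exists_polynomial_near_of_deriv_two {f f' f'' : ℝ → ℝ}
    (hf : ∀ z ∈ Icc (-1 : ℝ) 1, HasDerivAt f (f' z) z)
    (hf' : ∀ z ∈ Icc (-1 : ℝ) 1, HasDerivAt f' (f'' z) z)
    (hc : ContinuousOn f'' (Icc (-1) 1)) {ε : ℝ} (hε : 0 < ε) :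
    ∃ P : ℝ[X], ∀ z ∈ Icc (-1 : ℝ) 1, |P.eval z - f z| ≤ ε ∧
      |(derivative P).eval z - f' z| ≤ ε ∧ |(derivative (derivative P)).eval z - f'' z| ≤ ε := by
  -- Approximate `f''` and integrate twice from `0`; the error does not grow, because `|z| ≤ 1`.
  obtain ⟨q, hq⟩ := exists_polynomial_near_of_continuousOn (-1) 1 f'' hc ε hε
  obtain ⟨R, rfl, hR⟩ := exists_antiderivative q (f' 0)
  obtain ⟨P, rfl, hP⟩ := exists_antiderivative R (f 0)
  have h2 := fun z hz => (hq z hz).le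
  have h1 := fun z hz => abs_eval_sub_le hf' hR h2 (z := z) hz
  exact ⟨P, fun z hz => ⟨abs_eval_sub_le hf hP h1 hz, h1 z hz, h2 z hz⟩⟩

theorem continuousOn_deficitRate {X : Type*} [TopologicalSpace X] {s : Set X} (d : ℕ) (p : ℝ)
    {a b : X → ℝ} (ha : ContinuousOn a s) (hb : ContinuousOn b s) :
    ContinuousOn (fun x => deficitRate d p (a x) (b x)) s := by
  unfold deficitRate
  fun_prop

theorem continuousOn_deficit (d : ℕ) (p : ℝ) {s : Set (ℝ × ℝ × ℝ × ℝ)}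
    (hs : ∀ q ∈ s, 0 < q.2.1) :
    ContinuousOn (fun q : ℝ × ℝ × ℝ × ℝ => q.2.1 ^ (2 / p) * (1 - q.1 ^ 2) ^ 2 *
      deficitRate d p (q.2.2.1 / q.2.1) (q.2.2.2 / q.2.1)) s := by
  have hr : ContinuousOn (fun q : ℝ × ℝ × ℝ × ℝ => q.2.1) s := by fun_prop
  have h0 : ∀ q ∈ s, q.2.1 ≠ 0 := fun q hq => (hs q hq).ne'
  have hw := hr.rpow_const (p := 2 / p) fun q hq => Or.inl (h0 q hq)
  have ha : ContinuousOn (fun q : ℝ × ℝ × ℝ × ℝ => q.2.2.1 / q.2.1) s :=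
    ContinuousOn.div (by fun_prop) hr h0
  have hb : ContinuousOn (fun q : ℝ × ℝ × ℝ × ℝ => q.2.2.2 / q.2.1) s :=
    ContinuousOn.div (by fun_prop) hr h0
  have hv : ContinuousOn (fun q : ℝ × ℝ × ℝ × ℝ => (1 - q.1 ^ 2) ^ 2) s := by fun_prop
  exact (hw.mul hv).mul (continuousOn_deficitRate d p ha hb)

/-- If the deficit functional is positive at a positive function of class `C²`, then it is positive
at some positive polynomial. -/
theorem exists_polynomial_deficit_pos {p : ℝ} {f f' f'' : ℝ → ℝ}
    (hf : ∀ z ∈ Icc (-1 : ℝ) 1, HasDerivAt f (f' z) z)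
    (hf' : ∀ z ∈ Icc (-1 : ℝ) 1, HasDerivAt f' (f'' z) z)
    (hc : ContinuousOn f'' (Icc (-1) 1)) (hpos : ∀ z ∈ Icc (-1 : ℝ) 1, 0 < f z)
    (hI : 0 < ∫ x : Sph d, f (height x) ^ (2 / p) * (1 - height x ^ 2) ^ 2 *
      deficitRate d p (f' (height x) / f (height x)) (f'' (height x) / f (height x)) ∂(unif d)) :
    ∃ P : ℝ[X], (∀ z ∈ Icc (-1 : ℝ) 1, 0 < P.eval z) ∧
      0 < ∫ x : Sph d, P.eval (height x) ^ (2 / p) * (1 - height x ^ 2) ^ 2 *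
        deficitRate d p ((derivative P).eval (height x) / P.eval (height x))
          ((derivative (derivative P)).eval (height x) / P.eval (height x)) ∂(unif d) := by
  choose P hP using fun n : ℕ => exists_polynomial_near_of_deriv_two hf hf' hc
    (ε := 1 / ((n : ℝ) + 1)) (by positivity)
  have hcf : ContinuousOn f (Icc (-1) 1) := fun z hz => (hf z hz).continuousAt.continuousWithinAt
  have hcf' : ContinuousOn f' (Icc (-1) 1) :=
    fun z hz => (hf' z hz).continuousAt.continuousWithinAt
  obtain ⟨z₀, hz₀, hmin⟩ := isCompact_Icc.exists_isMinOn
    (nonempty_Icc.2 (by norm_num : (-1 : ℝ) ≤ 1)) hcf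
  obtain ⟨M₀, hM₀⟩ := isCompact_Icc.exists_bound_of_continuousOn hcf
  obtain ⟨M₁, hM₁⟩ := isCompact_Icc.exists_bound_of_continuousOn hcf'
  obtain ⟨M₂, hM₂⟩ := isCompact_Icc.exists_bound_of_continuousOn hc
  have hm := hpos z₀ hz₀
  -- A compact set of values `(z, f, f', f'')` with the second entry bounded away from `0`. It
  -- contains the limit and all close approximants, and the integrand is continuous and bounded on
  -- it, so dominated convergence applies.
  set K : Set (ℝ × ℝ × ℝ × ℝ) := Icc (-1) 1 ×ˢ Icc (f z₀ / 2) (M₀ + 1) ×ˢ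
    Icc (-(M₁ + 1)) (M₁ + 1) ×ˢ Icc (-(M₂ + 1)) (M₂ + 1) with hK
  have hKc : IsCompact K := isCompact_Icc.prod (isCompact_Icc.prod
    (isCompact_Icc.prod isCompact_Icc))
  have hcont := continuousOn_deficit d p (s := K) fun q hq => lt_of_lt_of_le (by positivity) hq.2.1.1
  obtain ⟨B, hB⟩ := hKc.exists_bound_of_continuousOn hcont
  have hlim : Tendsto (fun n : ℕ => 1 / ((n : ℝ) + 1)) atTop (𝓝 0) :=
    tendsto_one_div_add_atTop_nhds_zero_nat
  have hmem : ∀ᶠ n : ℕ in atTop, ∀ z ∈ Icc (-1 : ℝ) 1, (z, (P n).eval z, (derivative (P n)).eval z,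
      (derivative (derivative (P n))).eval z) ∈ K := by
    filter_upwards [hlim.eventually (gt_mem_nhds (show 0 < min (f z₀ / 2) 1 by positivity))]
      with n hn z hz
    obtain ⟨h0, h1, h2⟩ := hP n z hz
    have hn1 := hn.trans_le (min_le_left _ _)
    have hn2 := hn.trans_le (min_le_right _ _)
    have hmz : f z₀ ≤ f z := hmin hz
    have hb0 := abs_le.1 (hM₀ z hz)
    have hb1 := abs_le.1 (hM₁ z hz)
    have hb2 := abs_le.1 (hM₂ z hz)
    rw [abs_le] at h0 h1 h2
    refine ⟨hz, ⟨?_, ?_⟩, ⟨?_, ?_⟩, ⟨?_, ?_⟩⟩ <;> dsimp only <;> linarith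
  have hmemf : ∀ z ∈ Icc (-1 : ℝ) 1, (z, f z, f' z, f'' z) ∈ K := by
    intro z hz
    have hmz : f z₀ ≤ f z := hmin hz
    have hb0 := abs_le.1 (hM₀ z hz)
    have hb1 := abs_le.1 (hM₁ z hz)
    have hb2 := abs_le.1 (hM₂ z hz)
    refine ⟨hz, ⟨?_, ?_⟩, ⟨?_, ?_⟩, ⟨?_, ?_⟩⟩ <;> dsimp only <;> linarith
  have hsq : ∀ {u : ℕ → ℝ} {l : ℝ}, (∀ n, |u n - l| ≤ 1 / ((n : ℝ) + 1)) →
      Tendsto u atTop (𝓝 l) := fun h =>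
    tendsto_iff_norm_sub_tendsto_zero.2 (squeeze_zero (fun _ => norm_nonneg _) h hlim)
  have htend : Tendsto (fun n => ∫ x : Sph d, (P n).eval (height x) ^ (2 / p) *
      (1 - height x ^ 2) ^ 2 *
        deficitRate d p ((derivative (P n)).eval (height x) / (P n).eval (height x))
          ((derivative (derivative (P n))).eval (height x) / (P n).eval (height x)) ∂(unif d))
      atTop (𝓝 (∫ x : Sph d, f (height x) ^ (2 / p) * (1 - height x ^ 2) ^ 2 *
        deficitRate d p (f' (height x) / f (height x)) (f'' (height x) / f (height x))
        ∂(unif d))) := by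
    refine tendsto_integral_filter_of_dominated_convergence (fun _ => B) ?_ ?_
      (integrable_const _) ?_
    · filter_upwards [hmem] with n hn
      have h : ContinuousOn (fun z => (z, (P n).eval z, (derivative (P n)).eval z,
          (derivative (derivative (P n))).eval z)) (Icc (-1) 1) :=
        (continuous_id.prodMk ((P n).continuous.prodMk ((derivative (P n)).continuous.prodMk
          (derivative (derivative (P n))).continuous))).continuousOn
      exact (continuous_zonal (hcont.comp h hn)).aestronglyMeasurable
    · filter_upwards [hmem] with n hn
      exact Eventually.of_forall fun x => hB _ (hn _ (height_mem x))
    · refine Eventually.of_forall fun x => ?_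
      have hx := height_mem x
      refine (hcont _ (hmemf _ hx)).tendsto.comp (tendsto_nhdsWithin_iff.2
        ⟨?_, hmem.mono fun n hn => hn _ hx⟩)
      exact tendsto_const_nhds.prodMk_nhds ((hsq fun n => (hP n _ hx).1).prodMk_nhds
        ((hsq fun n => (hP n _ hx).2.1).prodMk_nhds (hsq fun n => (hP n _ hx).2.2)))
  obtain ⟨n, hn, hn'⟩ := (hmem.and (htend.eventually (lt_mem_nhds hI))).exists
  exact ⟨P n, fun z hz => lt_of_lt_of_le (by positivity) (hn z hz).2.1.1, hn'⟩

/-! ### The extremal profile -/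

theorem hasDerivAt_two_sub_rpow (q : ℝ) {z : ℝ} (hz : z < 2) :
    HasDerivAt (fun z : ℝ => (2 - z) ^ (-q)) (q * (2 - z) ^ (-(q + 1))) z := by
  have h1 : HasDerivAt (fun z : ℝ => 2 - z) (-1) z := (hasDerivAt_id z).const_sub 2
  refine (h1.rpow_const (p := -q) (Or.inl (by linarith))).congr_deriv ?_
  rw [neg_add']
  ring

/-- A power `(2 - z)^(-m)` satisfies `b = a² (m+1)/m`, and `(κ - 1) m = p` turns this into `X = κY`,
the minimum in `X` of `X² - 2κXY + cY²`, with value `(c - κ²) Y²`. -/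
theorem deficitRate_extremal {p κ m a : ℝ} (hp : p ≠ 0) (hκ : κ = (p - 1) * (d - 1) / (d + 2))
    (hm : (κ - 1) * m = p) (hm0 : m ≠ 0) :
    deficitRate d p a (a ^ 2 * ((m + 1) / m)) =
      2 * (κ ^ 2 - (p - 1) * d / (d + 2)) * a ^ 4 / p ^ 4 := by
  unfold deficitRate
  rw [← hκ]
  have h : a ^ 2 * ((m + 1) / m) / p + 1 / p * (1 / p - 1) * a ^ 2 = κ * (a ^ 2 / p ^ 2) := by
    field_simp
    linear_combination (-a ^ 2) * hm
  rw [h]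
  ring

theorem exists_polynomial_deficit_pos_of_lt (hd : 2 ≤ d) {p : ℝ}
    (hp : (2 * (d : ℝ) ^ 2 + 1) / ((d : ℝ) - 1) ^ 2 < p) (hp2 : 2 < p) :
    ∃ P : ℝ[X], (∀ z ∈ Icc (-1 : ℝ) 1, 0 < P.eval z) ∧
      0 < ∫ x : Sph d, P.eval (height x) ^ (2 / p) * (1 - height x ^ 2) ^ 2 *
        deficitRate d p ((derivative P).eval (height x) / P.eval (height x))
          ((derivative (derivative P)).eval (height x) / P.eval (height x)) ∂(unif d) := by
  have hd2 : (2 : ℝ) ≤ d := by exact_mod_cast hd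
  have hd1 : (0 : ℝ) < d - 1 := by linarith
  rw [div_lt_iff₀ (by positivity)] at hp
  -- The condition `2^# < p` rewritten, since `d(d+2) + (d-1)² = 2d² + 1`.
  have hkey : d * (d + 2) < (p - 1) * ((d : ℝ) - 1) ^ 2 := by nlinarith
  set κ : ℝ := (p - 1) * (d - 1) / (d + 2) with hκ
  -- Makes the exponent `m` positive, so that `ρ` is a negative power of `2 - z`.
  have hκ1 : 1 < κ := by
    rw [hκ, lt_div_iff₀ (by positivity)]
    nlinarith
  have hκc : 0 < κ ^ 2 - (p - 1) * d / (d + 2) := by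
    have : κ ^ 2 - (p - 1) * d / (d + 2) =
        (p - 1) / (d + 2) ^ 2 * ((p - 1) * ((d : ℝ) - 1) ^ 2 - d * (d + 2)) := by
      rw [hκ]
      field_simp
    rw [this]
    have : 0 < p - 1 := by linarith
    have := sub_pos.2 hkey
    positivity
  set m : ℝ := p / (κ - 1) with hm
  have hκ1' : 0 < κ - 1 := by linarith
  have hm0 : 0 < m := div_pos (by linarith) hκ1'
  have hκm : (κ - 1) * m = p := by
    rw [hm]
    field_simp
  have hlt : ∀ z ∈ Icc (-1 : ℝ) 1, z < 2 := fun z hz => by linarith [hz.2]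
  have hrpow : ∀ q : ℝ, ContinuousOn (fun z : ℝ => (2 - z) ^ (-q)) (Icc (-1) 1) := fun q z hz =>
    (hasDerivAt_two_sub_rpow q (hlt z hz)).continuousAt.continuousWithinAt
  have hfpos : ∀ q : ℝ, ∀ z ∈ Icc (-1 : ℝ) 1, 0 < (2 - z) ^ (-q) := fun q z hz =>
    Real.rpow_pos_of_pos (by linarith [hlt z hz]) _
  -- The number `2` only has to exceed `1`: the singularity lies off `[-1, 1]`, and `a = m / (2 -
  -- z)` never vanishes.
  refine exists_polynomial_deficit_pos (f := fun z => (2 - z) ^ (-m))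
    (f' := fun z => m * (2 - z) ^ (-(m + 1)))
    (f'' := fun z => m * ((m + 1) * (2 - z) ^ (-(m + 1 + 1))))
    (fun z hz => hasDerivAt_two_sub_rpow m (hlt z hz))
    (fun z hz => (hasDerivAt_two_sub_rpow (m + 1) (hlt z hz)).const_mul m)
    (continuousOn_const.mul (continuousOn_const.mul (hrpow _))) (hfpos m) ?_
  have hquot : ∀ z ∈ Icc (-1 : ℝ) 1, m * (2 - z) ^ (-(m + 1)) / (2 - z) ^ (-m) = m / (2 - z) ∧
      m * ((m + 1) * (2 - z) ^ (-(m + 1 + 1))) / (2 - z) ^ (-m) =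
        (m / (2 - z)) ^ 2 * ((m + 1) / m) := by
    intro z hz
    have h2 : 2 - z ≠ 0 := by linarith [hlt z hz]
    have h3 := (hfpos m z hz).ne'
    simp only [neg_add', Real.rpow_sub_one h2]
    constructor <;> field_simp
  refine integral_zonal_pos (by omega) (g := fun z => ((2 - z) ^ (-m)) ^ (2 / p) *
    (1 - z ^ 2) ^ 2 * deficitRate d p (m * (2 - z) ^ (-(m + 1)) / (2 - z) ^ (-m))
      (m * ((m + 1) * (2 - z) ^ (-(m + 1 + 1))) / (2 - z) ^ (-m))) ?_ ?_
  · exact (continuousOn_deficit d p (s := {q | 0 < q.2.1}) fun q hq => hq).comp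
      (f := fun z => (z, (2 - z) ^ (-m), m * (2 - z) ^ (-(m + 1)),
        m * ((m + 1) * (2 - z) ^ (-(m + 1 + 1)))))
      (continuousOn_id.prodMk ((hrpow _).prodMk ((continuousOn_const.mul (hrpow _)).prodMk
        (continuousOn_const.mul (continuousOn_const.mul (hrpow _)))))) (hfpos m)
  · intro z hz
    have hz' := Ioo_subset_Icc_self hz
    rw [(hquot z hz').1, (hquot z hz').2, deficitRate_extremal (by linarith) hκ hκm hm0.ne']
    have h1 : 0 < 1 - z ^ 2 := by nlinarith [hz.1, hz.2]
    have h2 : 0 < 2 - z := by linarith [hlt z hz']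
    have h3 := hfpos m z hz'
    positivity

/-- The case `d = 1` is excluded because there `2^# = ∞`; for `d ≥ 2`, `2^# > 2` because `2d² + 1 >
2(d-1)²`. -/
theorem lt_of_twoSharp_lt {p : ℝ} (hd : 1 ≤ d) (hp : twoSharp d < ENNReal.ofReal p) :
    2 ≤ d ∧ (2 * (d : ℝ) ^ 2 + 1) / ((d : ℝ) - 1) ^ 2 < p ∧ 2 < p := by
  unfold twoSharp at hp
  split_ifs at hp with h
  · exact absurd hp not_top_lt
  have hd2 : 2 ≤ d := by omega
  have hd2' : (2 : ℝ) ≤ d := by exact_mod_cast hd2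
  have hlt := (ENNReal.ofReal_lt_ofReal_iff'.1 hp).1
  refine ⟨hd2, hlt, lt_trans ?_ hlt⟩
  have : 0 < (d : ℝ) - 1 := by linarith
  rw [lt_div_iff₀ (by positivity)]
  nlinarith

end Sph

theorem mainTheorem9 (d : ℕ) (hd : 1 ≤ d) (p : ℝ)
    (hp : Sph.twoSharp d < ENNReal.ofReal p)
    (hp' : ENNReal.ofReal p < Sph.twoStar d ∨ (3 ≤ d ∧ ENNReal.ofReal p = Sph.twoStar d)) :
    ∃ ρ₀ : Sph d → ℝ,
      ContMDiff (𝓡 d) 𝓘(ℝ, ℝ) ∞ ρ₀ ∧ (∀ x, 0 < ρ₀ x) ∧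
      (∃ ρ : ℝ → Sph d → ℝ, Sph.IsHeatSolution ρ₀ ρ) ∧
      ∀ ρ : ℝ → Sph d → ℝ, Sph.IsHeatSolution ρ₀ ρ →
        ∃ c : ℝ, 0 < c ∧
          HasDerivWithinAt (fun t => Sph.fisher p (ρ t) - d * Sph.entropy p (ρ t)) c
            (Set.Ici 0) 0 := by
  obtain ⟨hd2, hlt, hp2⟩ := Sph.lt_of_twoSharp_lt hd hp
  obtain ⟨P, hpos, hI⟩ := Sph.exists_polynomial_deficit_pos_of_lt hd2 hlt hp2
  obtain ⟨Q, rfl, hc, hQ⟩ := Sph.exists_zonal_heat_flow hd P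
  have hsol := Sph.isHeatSolution_zonal (d := d) (hc LinearMap.id) (hQ LinearMap.id)
  refine ⟨fun x => (Q 0).eval (Sph.height x),
    Sph.contMDiff_zonal (Sph.contDiff_eval (Q 0) ∞), fun x => hpos _ (Sph.height_mem x),
    ⟨_, hsol⟩, fun ρ hρ => ⟨_, hI, ?_⟩⟩
  rw [← Sph.integral_rate_eq hp2 hpos]
  refine ((Sph.hasDerivAt_fisher_flow hc hQ hpos).sub
    ((Sph.hasDerivAt_entropy_flow hc hQ hpos).const_mul (d : ℝ))).hasDerivWithinAt.congr
    (fun t ht => ?_) ?_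
  -- An arbitrary solution agrees with the explicit one only for `t ≥ 0`, hence the derivative
  -- within `[0, ∞)`.
  · rw [hρ.unique hsol ht]
    rfl
  · rw [hρ.unique hsol le_rfl]
    rfl
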